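/- Let $X$ be a real Banach lattice that is order continuous, i.e. every decreasing sequence of positive elements of $X$ converges in norm. **(Real case.)** For $x,y\in X$ put $b(x,y)=|x|\wedge y_+-|x|\wedge y_-$, where $y_+=y\vee 0$ and $y_-=(-y)\vee 0$. A band is a set of the form $A^\perp=\{x\in X:\ |x|\wedge|a|=0 \text{ for all } a\in A\}$ with $A\subseteq X$. A sign change on $X$ is an isometry of the form $U=2P-I$, where $P$ is a band projection, i.e. the projection onto a band $B$ along $B^\perp$, where $X=B\oplus B^\perp$. Then for every closed linear subspace $E$ of $X$ the following are equivalent: 1. there is a sign change $U$ on $X$ such that $U(E)$ is a closed vector sublattice of $X$ (a linear subspace closed under $\vee$ and $\wedge$); 2. $b(x,y)\in E$ for all $x,y\in E$. **(Complex case.)** Let $X_{\mathbb C}=X+iX$ be the complexification of $X$, with modulus $|a+ib|=\bigvee_{\theta}\big((\cos\theta)a+(\sin\theta)b\big)\in X$ and norm $\|z\|=\|\,|z|\,\|_X$; every order continuous complex Banach lattice is of this form. For $y\in X_{\mathbb C}$ let $\mathcal I(y)$ be the closed ideal generated by $y$, that is, the closure of $\{z\in X_{\mathbb C}:\ |z|\le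 n|y| \text{ for some } n\in\mathbb N\}$, and let $S_y$ be the sign of $y$, that is, the unique complex linear operator $S_y:\mathcal I(y)\to\mathcal I(y)$ with $|S_yz|=|z|$ for all $z\in\mathcal I(y)$ and $S_y|y|=y$. For $x,y\in X_{\mathbb C}$ put $b(x,y)=S_y(|x|\wedge|y|)$. A complex sign change is a complex linear map $U:X_{\mathbb C}\to X_{\mathbb C}$ with $|Uz|=|z|$ for all $z\in X_{\mathbb C}$. Then for every closed complex linear subspace $E$ of $X_{\mathbb C}$ the following are equivalent: 1. there is a complex sign change $U$ such that $U(E)$ is a closed complex vector sublattice of $X_{\mathbb C}$, i.e. $U(E)=Y+iY$ for some closed vector sublattice $Y$ of $X$; 2. $b(x,y)\in E$ for all $x,y\in E$. -/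

import Mathlib

open Filter Topology

namespace BLat

/-! ### Real Banach lattices -/

section Real

variable {X : Type*} [NormedAddCommGroup X] [Lattice X]

/-- Order continuity: every decreasing sequence of positive elements converges in norm. -/
def IsOrderContinuous (X : Type*) [NormedAddCommGroup X] [Lattice X] : Prop :=
  ∀ u : ℕ → X, Antitone u → (∀ n, 0 ≤ u n) → ∃ l : X, Tendsto u atTop (𝓝 l)

/-- The set of all elements that are disjoint from every element of `A`. -/
def disjointCompl (A : Set X) : Set X := {x | ∀ y ∈ A, |x| ⊓ |y| = 0}

/-- A band is a set of the form `A^⊥`. -/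
def IsBand (B : Set X) : Prop := ∃ A : Set X, B = disjointCompl A

/-- `b(x,y) = |x| ∧ y₊ - |x| ∧ y₋`. -/
def laceyReal (x y : X) : X := |x| ⊓ y⁺ - |x| ⊓ y⁻

variable [NormedSpace ℝ X]

/-- A linear subspace closed under the two lattice operations. -/
def IsVectorSublattice (E : Submodule ℝ X) : Prop :=
  ∀ x ∈ E, ∀ y ∈ E, x ⊔ y ∈ E ∧ x ⊓ y ∈ E

/-- `P` is the projection onto a band `B` along `B^⊥` (so that `X = B ⊕ B^⊥`). -/
def IsBandProjection (P : X →ₗ[ℝ] X) : Prop :=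
  ∃ B : Set X, IsBand B ∧ ∀ x, P x ∈ B ∧ x - P x ∈ disjointCompl B

/-- A sign change is an isometry of the form `2P - I` with `P` a band projection. -/
def IsSignChange (U : X →ₗ[ℝ] X) : Prop :=
  Isometry U ∧ ∃ P : X →ₗ[ℝ] X, IsBandProjection P ∧ U = (2 : ℝ) • P - LinearMap.id

/-- Some sign change on `X` maps `E` onto a closed vector sublattice of `X`. -/
def IsClosedSublatticeUpToSignChange (E : Submodule ℝ X) : Prop :=
  ∃ U : X →ₗ[ℝ] X, IsSignChange U ∧
    IsClosed (E.map U : Set X) ∧ IsVectorSublattice (E.map U)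

end Real

/-! ### The complexification of a real Banach lattice -/

/-- The elements `a + i b` of the complexification `X + iX`. -/
@[ext]
structure Complexification (X : Type*) where
  re : X
  im : X

namespace Complexification

section Algebra

variable {X : Type*} [AddCommGroup X]

instance : Zero (Complexification X) := ⟨⟨0, 0⟩⟩
instance : Add (Complexification X) := ⟨fun z w => ⟨z.re + w.re, z.im + w.im⟩⟩
instance : Neg (Complexification X) := ⟨fun z => ⟨-z.re, -z.im⟩⟩
instance : Sub (Complexification X) := ⟨fun z w => ⟨z.re - w.re, z.im - w.im⟩⟩

@[simp] theorem zero_re : (0 : Complexification X).re = 0 := rfl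
@[simp] theorem zero_im : (0 : Complexification X).im = 0 := rfl
@[simp] theorem add_re (z w : Complexification X) : (z + w).re = z.re + w.re := rfl
@[simp] theorem add_im (z w : Complexification X) : (z + w).im = z.im + w.im := rfl
@[simp] theorem neg_re (z : Complexification X) : (-z).re = -z.re := rfl
@[simp] theorem neg_im (z : Complexification X) : (-z).im = -z.im := rfl
@[simp] theorem sub_re (z w : Complexification X) : (z - w).re = z.re - w.re := rfl
@[simp] theorem sub_im (z w : Complexification X) : (z - w).im = z.im - w.im := rfl

instance : AddCommGroup (Complexification X) where
  add_assoc z w v := by ext <;> simp [add_assoc]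
  zero_add z := by ext <;> simp
  add_zero z := by ext <;> simp
  nsmul := nsmulRec
  zsmul := zsmulRec
  neg_add_cancel z := by ext <;> simp
  add_comm z w := by ext <;> simp [add_comm]
  sub_eq_add_neg z w := by ext <;> simp [sub_eq_add_neg]

/-- The inclusion of `X` as the real part of its complexification. -/
def ofReal (x : X) : Complexification X := ⟨x, 0⟩

variable [Module ℝ X]

instance : SMul ℂ (Complexification X) :=
  ⟨fun c z => ⟨c.re • z.re - c.im • z.im, c.re • z.im + c.im • z.re⟩⟩

@[simp] theorem smul_re (c : ℂ) (z : Complexification X) :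
    (c • z).re = c.re • z.re - c.im • z.im := rfl
@[simp] theorem smul_im (c : ℂ) (z : Complexification X) :
    (c • z).im = c.re • z.im + c.im • z.re := rfl

instance : Module ℂ (Complexification X) where
  one_smul z := by ext <;> simp
  mul_smul c d z := by ext <;> simp <;> module
  smul_zero c := by ext <;> simp
  smul_add c z w := by ext <;> simp <;> module
  add_smul c d z := by ext <;> simp <;> module
  zero_smul z := by ext <;> simp

end Algebra

section Modulus

variable {X : Type*} [NormedAddCommGroup X] [NormedSpace ℝ X]

/-- The real element `(cos θ) a + (sin θ) b`, for `z = a + i b`. -/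
noncomputable def rot (z : Complexification X) (θ : ℝ) : X :=
  Real.cos θ • z.re + Real.sin θ • z.im

variable [Lattice X]

theorem smul_le_abs_smul [IsOrderedAddMonoid X] [IsOrderedModule ℝ X] (t : ℝ) (x : X) : t • x ≤ |t| • |x| := by
  rcases le_total 0 t with h | h
  · rw [abs_of_nonneg h]
    exact smul_le_smul_of_nonneg_left (le_abs_self x) h
  · rw [abs_of_nonpos h, ← neg_smul_neg]
    exact smul_le_smul_of_nonneg_left (neg_le_abs x) (neg_nonneg.2 h)

variable [IsOrderedAddMonoid X] [IsOrderedModule ℝ X]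

theorem rot_le_rot_add (z : Complexification X) (s t : ℝ) :
    rot z s ≤ rot z t + |s - t| • (|z.re| + |z.im|) := by
  have h1 : |Real.cos s - Real.cos t| ≤ |s - t| := by
    simpa [Real.dist_eq] using Real.lipschitzWith_cos.dist_le_mul s t
  have h2 : |Real.sin s - Real.sin t| ≤ |s - t| := by
    simpa [Real.dist_eq] using Real.lipschitzWith_sin.dist_le_mul s t
  have e : rot z s = rot z t +
      ((Real.cos s - Real.cos t) • z.re + (Real.sin s - Real.sin t) • z.im) := by
    simp only [rot]; module
  rw [e, smul_add]
  gcongr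
  · exact (smul_le_abs_smul _ _).trans (smul_le_smul_of_nonneg_right h1 (abs_nonneg _))
  · exact (smul_le_abs_smul _ _).trans (smul_le_smul_of_nonneg_right h2 (abs_nonneg _))

variable [HasSolidNorm X] [CompleteSpace X]

/-- The supremum of all `(cos θ) a + (sin θ) b` exists in every Banach lattice. -/
theorem exists_isLUB_rot (z : Complexification X) : ∃ m, IsLUB (Set.range (rot z)) m := by
  set e : X := |z.re| + |z.im| with he
  have he0 : 0 ≤ e := add_nonneg (abs_nonneg _) (abs_nonneg _)
  have hne : ∀ n : ℕ, (Finset.range (7 * (n + 1) + 1)).Nonempty := fun n => by simp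
  let u : ℕ → X := fun n =>
    (Finset.range (7 * (n + 1) + 1)).sup' (hne n) fun k => rot z ((k : ℝ) / (n + 1))
  have hub : ∀ n θ, rot z θ ≤ u n + (1 / ((n : ℝ) + 1)) • e := by
    intro n θ
    have hper : Function.Periodic (rot z) (2 * Real.pi) := fun t => by simp [rot]
    obtain ⟨t, ht, hθ⟩ := hper.exists_mem_Ico₀ Real.two_pi_pos θ
    rw [hθ]
    have hn : (0 : ℝ) < (n : ℝ) + 1 := by positivity
    have ht7 : t < 7 := by linarith [ht.2, Real.pi_lt_d2]
    have ht0 : 0 ≤ t * ((n : ℝ) + 1) := mul_nonneg ht.1 hn.le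
    set k := ⌊t * ((n : ℝ) + 1)⌋₊ with hk
    have hk1 : (k : ℝ) ≤ t * ((n : ℝ) + 1) := Nat.floor_le ht0
    have hk2 : t * ((n : ℝ) + 1) < k + 1 := Nat.lt_floor_add_one _
    have hmem : k ∈ Finset.range (7 * (n + 1) + 1) := by
      rw [Finset.mem_range, Nat.lt_succ_iff]
      have : (k : ℝ) ≤ ((7 * (n + 1) : ℕ) : ℝ) := by push_cast; nlinarith
      exact_mod_cast this
    have hd : |t - (k : ℝ) / (n + 1)| ≤ 1 / ((n : ℝ) + 1) := by
      have h3 : t - (k : ℝ) / (n + 1) = (t * ((n : ℝ) + 1) - k) / (n + 1) := by field_simp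
      rw [h3, abs_of_nonneg (div_nonneg (by linarith) hn.le)]
      gcongr
      linarith
    refine (rot_le_rot_add z t ((k : ℝ) / (n + 1))).trans (add_le_add ?_ ?_)
    · exact Finset.le_sup' (fun k : ℕ => rot z ((k : ℝ) / (n + 1))) hmem
    · exact smul_le_smul_of_nonneg_right hd he0
  have hle : ∀ n m, u m ≤ u n + (1 / ((n : ℝ) + 1)) • e := fun n m =>
    Finset.sup'_le _ _ fun k _ => hub n _
  have hcau : CauchySeq u := by
    refine cauchySeq_of_le_tendsto_0 (fun N : ℕ => (1 / ((N : ℝ) + 1)) * ‖e‖) ?_ ?_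
    · intro n m N hn hm
      have key : ∀ n m, N ≤ m → u n - u m ≤ (1 / ((N : ℝ) + 1)) • e := by
        intro n m hm
        have h1 : (1 / ((m : ℝ) + 1)) ≤ 1 / ((N : ℝ) + 1) := by gcongr
        have h2 := (hle m n).trans (add_le_add_right (smul_le_smul_of_nonneg_right h1 he0) (u m))
        exact sub_le_iff_le_add'.2 h2
      have h0 : 0 ≤ (1 / ((N : ℝ) + 1)) := by positivity
      have habs : |u n - u m| ≤ |(1 / ((N : ℝ) + 1)) • e| := by
        refine le_trans ?_ (le_abs_self _)
        refine abs_le'.2 ⟨key n m hm, ?_⟩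
        rw [neg_sub]
        exact key m n hn
      rw [dist_eq_norm]
      refine (norm_le_norm_of_abs_le_abs habs).trans ?_
      rw [norm_smul, Real.norm_of_nonneg h0]
    · simpa using tendsto_one_div_add_atTop_nhds_zero_nat.mul_const ‖e‖
  obtain ⟨m, hm⟩ := cauchySeq_tendsto_of_complete hcau
  refine ⟨m, ?_, ?_⟩
  · rintro _ ⟨θ, rfl⟩
    have hlim : Tendsto (fun n : ℕ => u n + (1 / ((n : ℝ) + 1)) • e) atTop (𝓝 m) := by
      simpa using hm.add
        ((tendsto_one_div_add_atTop_nhds_zero_nat (𝕜 := ℝ)).smul_const e)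
    exact ge_of_tendsto' hlim fun n => hub n θ
  · intro c hc
    exact le_of_tendsto' hm fun n => Finset.sup'_le _ _ fun k _ => hc ⟨_, rfl⟩

/-- The modulus `|a + i b| = ⋁_θ (cos θ) a + (sin θ) b`, an element of `X`. -/
noncomputable def modulus (z : Complexification X) : X := (exists_isLUB_rot z).choose

theorem isLUB_modulus (z : Complexification X) : IsLUB (Set.range (rot z)) (modulus z) :=
  (exists_isLUB_rot z).choose_spec

theorem rot_le_modulus (z : Complexification X) (θ : ℝ) : rot z θ ≤ modulus z :=
  (isLUB_modulus z).1 ⟨θ, rfl⟩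

theorem modulus_le {z : Complexification X} {c : X} (h : ∀ θ, rot z θ ≤ c) : modulus z ≤ c :=
  (isLUB_modulus z).2 (by rintro _ ⟨θ, rfl⟩; exact h θ)

theorem abs_re_le_modulus (z : Complexification X) : |z.re| ≤ modulus z :=
  abs_le'.2 ⟨by simpa [rot] using rot_le_modulus z 0,
    by simpa [rot] using rot_le_modulus z Real.pi⟩

theorem abs_im_le_modulus (z : Complexification X) : |z.im| ≤ modulus z :=
  abs_le'.2 ⟨by simpa [rot] using rot_le_modulus z (Real.pi / 2),
    by simpa [rot] using rot_le_modulus z (-(Real.pi / 2))⟩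

theorem modulus_nonneg (z : Complexification X) : 0 ≤ modulus z :=
  (abs_nonneg _).trans (abs_re_le_modulus z)

theorem modulus_add_le (z w : Complexification X) : modulus (z + w) ≤ modulus z + modulus w :=
  modulus_le fun θ => by
    have e : rot (z + w) θ = rot z θ + rot w θ := by simp only [rot, add_re, add_im]; module
    rw [e]
    exact add_le_add (rot_le_modulus z θ) (rot_le_modulus w θ)

theorem modulus_smul_le (c : ℂ) (z : Complexification X) : modulus (c • z) ≤ ‖c‖ • modulus z :=
  modulus_le fun θ => by
    have h1 : c.re = ‖c‖ * Real.cos c.arg := (Complex.norm_mul_cos_arg c).symm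
    have h2 : c.im = ‖c‖ * Real.sin c.arg := (Complex.norm_mul_sin_arg c).symm
    have e : rot (c • z) θ = ‖c‖ • rot z (θ - c.arg) := by
      simp only [rot, smul_re, smul_im, Real.cos_sub, Real.sin_sub]
      rw [h1, h2]
      module
    rw [e]
    exact smul_le_smul_of_nonneg_left (rot_le_modulus z _) (norm_nonneg c)

theorem modulus_smul (c : ℂ) (z : Complexification X) : modulus (c • z) = ‖c‖ • modulus z := by
  refine (modulus_smul_le c z).antisymm ?_
  rcases eq_or_ne c 0 with rfl | hc
  · simpa using modulus_nonneg (0 : Complexification X)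
  · have h := modulus_smul_le c⁻¹ (c • z)
    rw [inv_smul_smul₀ hc, norm_inv] at h
    have h' := smul_le_smul_of_nonneg_left h (norm_nonneg c)
    rwa [smul_inv_smul₀ (norm_ne_zero_iff.2 hc)] at h'

theorem modulus_zero : modulus (0 : Complexification X) = 0 := by
  simpa using modulus_smul 0 (0 : Complexification X)

theorem modulus_ofReal (x : X) : modulus (ofReal x) = |x| := by
  refine le_antisymm (modulus_le fun θ => ?_) (abs_re_le_modulus (ofReal x))
  have h : rot (ofReal x) θ ≤ |Real.cos θ| • |x| := by
    simpa [rot, ofReal] using smul_le_abs_smul (Real.cos θ) x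
  exact h.trans (by
    simpa using smul_le_smul_of_nonneg_right (Real.abs_cos_le_one θ) (abs_nonneg x))

/-- The norm `‖z‖ = ‖ |z| ‖`. -/
noncomputable instance : Norm (Complexification X) := ⟨fun z => ‖modulus z‖⟩

theorem norm_def (z : Complexification X) : ‖z‖ = ‖modulus z‖ := rfl

theorem normCore : NormedSpace.Core ℂ (Complexification X) where
  norm_nonneg z := norm_nonneg (modulus z)
  norm_smul c z := by simp [norm_def, modulus_smul, norm_smul]
  norm_triangle z w := by
    refine le_trans (norm_le_norm_of_abs_le_abs ?_) (norm_add_le (modulus z) (modulus w))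
    rw [abs_of_nonneg (modulus_nonneg _),
      abs_of_nonneg (add_nonneg (modulus_nonneg z) (modulus_nonneg w))]
    exact modulus_add_le z w
  norm_eq_zero_iff z := by
    refine ⟨fun h => ?_, fun h => by rw [h, norm_def, modulus_zero, norm_zero]⟩
    have h0 : modulus z = 0 := norm_eq_zero.1 h
    have h1 : ‖z.re‖ ≤ ‖modulus z‖ := norm_le_norm_of_abs_le_abs
      ((abs_re_le_modulus z).trans (le_abs_self _))
    have h2 : ‖z.im‖ ≤ ‖modulus z‖ := norm_le_norm_of_abs_le_abs
      ((abs_im_le_modulus z).trans (le_abs_self _))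
    rw [h0, norm_zero] at h1 h2
    ext
    · exact norm_le_zero_iff.1 h1
    · exact norm_le_zero_iff.1 h2

noncomputable instance : NormedAddCommGroup (Complexification X) :=
  NormedAddCommGroup.ofCore normCore

noncomputable instance : NormedSpace ℂ (Complexification X) :=
  NormedSpace.ofCore normCore

/-- The ideal `{z : ∃ n, |z| ≤ n |y|}` generated by `y`. -/
def ideal₀ (y : Complexification X) : Submodule ℂ (Complexification X) where
  carrier := {z | ∃ n : ℕ, modulus z ≤ n • modulus y}
  zero_mem' := ⟨0, by simp [modulus_zero]⟩
  add_mem' := by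
    rintro z w ⟨n, hn⟩ ⟨m, hm⟩
    exact ⟨n + m, by rw [add_nsmul]; exact (modulus_add_le z w).trans (add_le_add hn hm)⟩
  smul_mem' := by
    rintro c z ⟨n, hn⟩
    refine ⟨⌈‖c‖⌉₊ * n, ?_⟩
    rw [modulus_smul, mul_nsmul', ← Nat.cast_smul_eq_nsmul ℝ]
    exact (smul_le_smul_of_nonneg_left hn (norm_nonneg c)).trans
      (smul_le_smul_of_nonneg_right (Nat.le_ceil _) (nsmul_nonneg (modulus_nonneg y) n))

/-- The closed ideal generated by `y`. -/
noncomputable def closedIdeal (y : Complexification X) : Submodule ℂ (Complexification X) :=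
  (ideal₀ y).topologicalClosure

theorem ofReal_mem_closedIdeal {y : Complexification X} {x : X} (h : |x| ≤ modulus y) :
    ofReal x ∈ closedIdeal y :=
  (ideal₀ y).le_topologicalClosure ⟨1, by rw [modulus_ofReal, one_nsmul]; exact h⟩

/-- The modulus of `y` as an element of the closed ideal generated by `y`. -/
noncomputable def modulusIn (y : Complexification X) : closedIdeal y :=
  ⟨ofReal (modulus y), ofReal_mem_closedIdeal (abs_of_nonneg (modulus_nonneg y)).le⟩

/-- `|x| ∧ |y|` as an element of the closed ideal generated by `y`. -/
noncomputable def infIn (x y : Complexification X) : closedIdeal y :=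
  ⟨ofReal (modulus x ⊓ modulus y), ofReal_mem_closedIdeal
    ((abs_of_nonneg (le_inf (modulus_nonneg x) (modulus_nonneg y))).le.trans inf_le_right)⟩

/-- `S` is a modulus preserving complex linear operator on the closed ideal generated by `y`
which sends `|y|` to `y`. -/
def IsSign (y : Complexification X) (S : closedIdeal y →ₗ[ℂ] closedIdeal y) : Prop :=
  (∀ z : closedIdeal y, modulus (S z : Complexification X) = modulus (z : Complexification X)) ∧
    (S (modulusIn y) : Complexification X) = y

/-- The sign `S_y` of `y`: the operator satisfying `IsSign y` (in a Banach lattice there is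
exactly one). -/
noncomputable def sign (y : Complexification X) : closedIdeal y →ₗ[ℂ] closedIdeal y :=
  Classical.epsilon (IsSign y)

/-- `b(x,y) = S_y (|x| ∧ |y|)`. -/
noncomputable def lacey (x y : Complexification X) : Complexification X := sign y (infIn x y)

/-- A complex sign change is a modulus preserving complex linear map. -/
def IsSignChange (U : Complexification X →ₗ[ℂ] Complexification X) : Prop :=
  ∀ z, modulus (U z) = modulus z

/-- `F` is the complexification of a closed vector sublattice of `X`. -/
def IsClosedSublattice (F : Submodule ℂ (Complexification X)) : Prop :=
  ∃ Y : Submodule ℝ X, IsClosed (Y : Set X) ∧ IsVectorSublattice Y ∧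
    ∀ z : Complexification X, z ∈ F ↔ z.re ∈ Y ∧ z.im ∈ Y

/-- Some complex sign change maps `E` onto a closed complex sublattice. -/
def IsClosedSublatticeUpToSignChange (E : Submodule ℂ (Complexification X)) : Prop :=
  ∃ U : Complexification X →ₗ[ℂ] Complexification X, IsSignChange U ∧
    IsClosedSublattice (E.map U)

end Modulus

end Complexification

end BLat

/-! In both cases `b(x,y)` is the only `v` with `|v| = |x| ∧ |y|` and `|y - v| = |y| - |x| ∧ |y|`
(`eq_laceyReal`, `Complexification.eq_lacey`): pointwise this is the equality case of the triangle
inequality. Hence every modulus preserving linear map commutes with `b`, and 1 ⇒ 2 reduces to closed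
sublattices being closed under `b`. In the real case this is visible from the formula. In the
complex case `b(x,y)` is the product of `y` and `|x| ∧ |y|` in the principal ideal with unit `|y|`,
and such products are limits of lattice expressions (`exists_mul`, `Complexification.lacey_mem`).

For 2 ⇒ 1, take a maximal disjoint family `S` in `E` and a sign change `U` with `U e = |e|` for `e ∈
S`. The set `C` of all `c = |g|` with `g ∈ E` and `U g = |g|` is closed under addition. Given `x ∈
E`, order continuity makes the truncations `|x| ∧ c` converge to some `l` with `|x| - l` disjoint
from `C` (`exists_tendsto_inf`). The elements `b(g,x)` of `E` converge to some `v ∈ E` with `|x - v|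
= |x| - l`; this is disjoint from `S`, so maximality gives `|x| = l`. Since `|x| ∧ c = U b(x,g)`
lies in `U(E)`, so does `|x| = |U x|`. Thus `U(E)` is closed under the modulus, which makes it a
sublattice; in the complex case real parts are recovered from moduli
(`Complexification.abs_modulus_add_sub_le`).

Pointwise arguments use characters, that is, normalised lattice homomorphisms on a principal ideal.
They determine its order (`le_of_forall_isCharacter`) and take the place of a representation by
continuous functions. -/

namespace BLat

/-! ### Elementary lattice identities -/

section Basics

theorem IsVectorSublattice.abs_mem {X : Type*} [NormedAddCommGroup X] [NormedSpace ℝ X] [Lattice X]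
    {Y : Submodule ℝ X} (hY : IsVectorSublattice Y) {x : X}
    (hx : x ∈ Y) : |x| ∈ Y :=
  (hY _ hx _ (neg_mem hx)).1

theorem eq_zero_of_abs_eq_zero {X : Type*} [NormedAddCommGroup X] [Lattice X]
    [IsOrderedAddMonoid X] [HasSolidNorm X] {x : X} (h : |x| = 0) : x = 0 := by
  rw [← norm_eq_zero, ← norm_abs_eq_norm, h, norm_zero]

variable {X : Type*} [NormedAddCommGroup X] [Lattice X] [IsOrderedAddMonoid X]

theorem inf_add_le_of_inf_eq_zero {w m v : X} (hm : 0 ≤ m) (hwv : w ⊓ v = 0) :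
    w ⊓ (m + v) ≤ m := by
  have h : w ⊓ (m + v) ≤ m + w ⊓ v := by
    rw [add_inf]
    exact inf_le_inf_right _ (le_add_of_nonneg_left hm)
  simpa [hwv] using h

theorem inf_nsmul_eq_zero {w v : X} (hw : 0 ≤ w) (hv : 0 ≤ v) (h : w ⊓ v = 0) (n : ℕ) :
    w ⊓ n • v = 0 := by
  induction n with
  | zero => simpa using hw
  | succ n ih =>
    refine le_antisymm ?_ (le_inf hw (nsmul_nonneg hv _))
    -- Applied to `w ∧ (n+1)v` in place of `w`: this element is disjoint from `v` and lies below `nv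
    -- + v`, hence below `nv`, where the induction hypothesis applies.
    have := inf_add_le_of_inf_eq_zero (w := w ⊓ (n + 1) • v) (m := n • v) (nsmul_nonneg hv n)
      (v := v) (le_antisymm ((inf_le_inf_right _ inf_le_left).trans h.le)
        (le_inf (le_inf hw (nsmul_nonneg hv _)) hv))
    rw [← succ_nsmul, inf_eq_left.2 inf_le_right] at this
    exact (le_inf inf_le_left this).trans ih.le

variable [NormedSpace ℝ X]

theorem injective_of_abs_eq [HasSolidNorm X] {U : X →ₗ[ℝ] X} (hU : ∀ x, |U x| = |x|) :
    Function.Injective U := by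
  refine (injective_iff_map_eq_zero U).2 fun z hz => ?_
  exact eq_zero_of_abs_eq_zero (by rw [← hU, hz, abs_zero])

/-- With the next identity this reduces both lattice operations to the modulus: a subspace closed
under `|·|` is a sublattice, and a linear map that respects `|·|` respects `⊔` and `⊓`. -/
theorem sup_eq_smul (x y : X) : x ⊔ y = (2⁻¹ : ℝ) • (x + y + |y - x|) := by
  rw [← two_nsmul_sup_eq_add_add_abs_sub, ← Nat.cast_smul_eq_nsmul ℝ, Nat.cast_ofNat,
    inv_smul_smul₀ two_ne_zero]

theorem inf_eq_smul (x y : X) : x ⊓ y = (2⁻¹ : ℝ) • (x + y - |y - x|) := by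
  rw [← two_nsmul_inf_eq_add_sub_abs_sub, ← Nat.cast_smul_eq_nsmul ℝ, Nat.cast_ofNat,
    inv_smul_smul₀ two_ne_zero]

end Basics

/-! ### Convergence of bounded monotone nets and truncations -/

section OrderContinuity

variable {X : Type*} [NormedAddCommGroup X] [Lattice X] [IsOrderedAddMonoid X] [HasSolidNorm X]

/-- In an order continuous Banach lattice, monotone nets that are bounded above converge. -/
theorem exists_isLUB_tendsto [CompleteSpace X] (hX : IsOrderContinuous X) {ι : Type*} [Preorder ι]
    [IsDirectedOrder ι] [Nonempty ι] {f : ι → X} (hf : Monotone f) {r : X} (hr : ∀ i, f i ≤ r) :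
    ∃ l, IsLUB (Set.range f) l ∧ Tendsto f atTop (𝓝 l) := by
  have key : ∀ ε > 0, ∃ N, ∀ n ≥ N, dist (f n) (f N) < ε := by
    -- The hypothesis concerns sequences only. If the net is not Cauchy, iterating the choice of a
    -- bad index gives an increasing sequence of indices with jumps at least `ε`, although the
    -- decreasing positive sequence `r - f (N k)` converges.
    by_contra! hcon
    obtain ⟨ε, hε, h⟩ := hcon
    choose g hg hg' using h
    let N : ℕ → ι := fun k => g^[k] (Classical.arbitrary ι)
    have hN : ∀ k, N (k + 1) = g (N k) := fun k => Function.iterate_succ_apply' g k _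
    have hmono : Monotone N := monotone_nat_of_le_succ fun k => by rw [hN]; exact hg _
    obtain ⟨l, hl⟩ := hX (fun k => r - f (N k))
      (fun a b hab => sub_le_sub_left (hf (hmono hab)) r) (fun k => sub_nonneg.2 (hr _))
    have h1 := ((tendsto_add_atTop_iff_nat 1).2 hl).sub hl
    rw [sub_self] at h1
    have h2 := h1.norm
    rw [norm_zero] at h2
    obtain ⟨k, hk⟩ := (h2.eventually (gt_mem_nhds hε)).exists
    have h3 := hg' (N k)
    rw [dist_eq_norm, ← hN, norm_sub_rev] at h3
    have : r - f (N (k + 1)) - (r - f (N k)) = f (N k) - f (N (k + 1)) := by abel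
    rw [this] at hk
    exact absurd hk (not_lt.2 h3)
  have hc : Cauchy (map f atTop) := by
    refine Metric.cauchy_iff.2 ⟨inferInstance, fun ε hε => ?_⟩
    obtain ⟨N, hN⟩ := key (ε / 2) (half_pos hε)
    refine ⟨f '' Set.Ici N, image_mem_map (Ici_mem_atTop N), ?_⟩
    rintro _ ⟨a, ha, rfl⟩ _ ⟨b, hb, rfl⟩
    calc dist (f a) (f b) ≤ dist (f a) (f N) + dist (f b) (f N) := dist_triangle_right _ _ _
      _ < ε := by linarith [hN a ha, hN b hb]
  obtain ⟨l, hl⟩ := CompleteSpace.complete hc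
  refine ⟨l, ⟨?_, ?_⟩, hl⟩
  · rintro _ ⟨i, rfl⟩
    exact ge_of_tendsto (f := f) hl ((eventually_ge_atTop i).mono fun j hj => hf hj)
  · intro b hb
    exact le_of_tendsto (f := f) hl (Eventually.of_forall fun i => hb ⟨i, rfl⟩)

/-- If `C` is a set of positive elements closed under addition, then the truncations `r ∧ c` with
`c ∈ C` converge, and the limit differs from `r` by an element that is disjoint from `C`. -/
theorem exists_tendsto_inf [CompleteSpace X] (hX : IsOrderContinuous X) {C : Set X}
    (h0 : (0 : X) ∈ C)
    (hC : ∀ c ∈ C, 0 ≤ c) (hadd : ∀ c ∈ C, ∀ d ∈ C, c + d ∈ C) {r : X} (hr : 0 ≤ r) :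
    ∃ (F : Filter C) (l : X), F.NeBot ∧ 0 ≤ l ∧ l ≤ r ∧
      Tendsto (fun c : C => r ⊓ c) F (𝓝 l) ∧ ∀ c ∈ C, (r - l) ⊓ c = 0 := by
  have : IsDirectedOrder C := ⟨fun a b => ⟨⟨a + b, hadd _ a.2 _ b.2⟩,
    le_add_of_nonneg_right (hC _ b.2), le_add_of_nonneg_left (hC _ a.2)⟩⟩
  have : Nonempty C := ⟨⟨0, h0⟩⟩
  obtain ⟨l, hl, ht⟩ := exists_isLUB_tendsto hX (f := fun c : C => r ⊓ c)
    (fun a b hab => inf_le_inf_left r hab) (r := r) (fun c => inf_le_left)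
  have hlr : l ≤ r := hl.2 (by rintro _ ⟨c, rfl⟩; exact inf_le_left)
  refine ⟨atTop, l, inferInstance, ?_, hlr, ht, fun c hc => ?_⟩
  · exact (le_inf hr le_rfl).trans (hl.1 ⟨⟨0, h0⟩, rfl⟩)
  · set w := (r - l) ⊓ c with hw
    have hw0 : 0 ≤ w := le_inf (sub_nonneg.2 hlr) (hC c hc)
    -- Since `r ∧ d + w ≤ r ∧ (d + c) ≤ l` for every `d ∈ C`, also `l - w` is an upper bound of the
    -- truncations, which forces `w = 0`.
    have h1 : l ≤ l - w := hl.2 (by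
      rintro _ ⟨d, rfl⟩
      rw [le_sub_iff_add_le]
      refine le_trans (le_inf ?_ ?_) (hl.1 ⟨⟨d + c, hadd _ d.2 _ hc⟩, rfl⟩)
      · calc r ⊓ d + w ≤ l + (r - l) := add_le_add (hl.1 ⟨d, rfl⟩) inf_le_left
          _ = r := by abel
      · exact add_le_add inf_le_right inf_le_right)
    exact le_antisymm (by simpa using h1) hw0

end OrderContinuity

/-! ### Principal ideals, their characters, and disjoint complements -/

section Characters

variable {X : Type*} [NormedAddCommGroup X] [NormedSpace ℝ X] [Lattice X] [IsOrderedAddMonoid X]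
  [IsOrderedModule ℝ X]

theorem abs_smul_eq (t : ℝ) (x : X) : |t • x| = |t| • |x| := by
  refine le_antisymm (abs_le'.2 ⟨Complexification.smul_le_abs_smul t x, ?_⟩) ?_
  · rw [← neg_smul, ← abs_neg t]
    exact Complexification.smul_le_abs_smul (-t) x
  · rcases le_total 0 t with h | h
    · rw [abs_of_nonneg h]
      rcases h.eq_or_lt with rfl | h
      · simp
      · have : |x| ≤ t⁻¹ • |t • x| := abs_le'.2
          ⟨by rw [le_inv_smul_iff_of_pos h]; exact le_abs_self _,
           by rw [le_inv_smul_iff_of_pos h, smul_neg]; exact neg_le_abs _⟩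
        rwa [le_inv_smul_iff_of_pos h] at this
    · rw [abs_of_nonpos h]
      rcases h.eq_or_lt with rfl | h
      · simp
      · have h' : 0 < -t := by linarith
        have : |x| ≤ (-t)⁻¹ • |t • x| := abs_le'.2
          ⟨by rw [le_inv_smul_iff_of_pos h', neg_smul]; exact neg_le_abs _,
           by rw [le_inv_smul_iff_of_pos h', smul_neg, neg_smul, neg_neg]; exact le_abs_self _⟩
        rwa [le_inv_smul_iff_of_pos h'] at this

/-- The ideal of all elements dominated by a multiple of `u`. -/
def principalIdeal (u : X) : Submodule ℝ X where
  carrier := {x | ∃ c : ℝ, |x| ≤ c • u}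
  zero_mem' := ⟨0, by simp⟩
  add_mem' := by
    rintro x y ⟨c, hc⟩ ⟨d, hd⟩
    exact ⟨c + d, (abs_add_le x y).trans (by rw [add_smul]; exact add_le_add hc hd)⟩
  smul_mem' := by
    rintro t x ⟨c, hc⟩
    exact ⟨|t| * c, by
      rw [abs_smul_eq, mul_smul]; exact smul_le_smul_of_nonneg_left hc (abs_nonneg t)⟩

theorem mem_principalIdeal_of_abs_le {u x y : X} (hx : x ∈ principalIdeal u) (h : |y| ≤ |x|) :
    y ∈ principalIdeal u :=
  hx.imp fun _ hc => h.trans hc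

theorem mem_principalIdeal_of_abs_le_self {u x : X} (h : |x| ≤ u) : x ∈ principalIdeal u :=
  ⟨1, by rwa [one_smul]⟩

theorem abs_mem_principalIdeal {u x : X} (hx : x ∈ principalIdeal u) : |x| ∈ principalIdeal u :=
  mem_principalIdeal_of_abs_le hx (abs_abs x).le

theorem sup_mem_principalIdeal {u x y : X} (hx : x ∈ principalIdeal u) (hy : y ∈ principalIdeal u) :
    x ⊔ y ∈ principalIdeal u := by
  rw [sup_eq_smul]
  exact Submodule.smul_mem _ _ (add_mem (add_mem hx hy) (abs_mem_principalIdeal (sub_mem hy hx)))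

theorem inf_mem_principalIdeal {u x y : X} (hx : x ∈ principalIdeal u) (hy : y ∈ principalIdeal u) :
    x ⊓ y ∈ principalIdeal u := by
  rw [inf_eq_smul]
  exact Submodule.smul_mem _ _ (sub_mem (add_mem hx hy) (abs_mem_principalIdeal (sub_mem hy hx)))

theorem self_mem_principalIdeal {u : X} (hu : 0 ≤ u) : u ∈ principalIdeal u :=
  mem_principalIdeal_of_abs_le_self (abs_of_nonneg hu).le

theorem mem_principalIdeal_of_nonneg_of_le {u f : X} (h0 : 0 ≤ f) (h1 : f ≤ u) :
    f ∈ principalIdeal u :=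
  mem_principalIdeal_of_abs_le_self (by rwa [abs_of_nonneg h0])

/-- `φ` restricts to a lattice homomorphism on the principal ideal of `u` with `φ u = 1`. -/
structure IsCharacter (u : X) (φ : X →ₗ[ℝ] ℝ) : Prop where
  map_unit : φ u = 1
  map_abs : ∀ x ∈ principalIdeal u, φ |x| = |φ x|

namespace IsCharacter

variable {u : X} {φ : X →ₗ[ℝ] ℝ}

theorem map_sup (h : IsCharacter u φ) {x y : X} (hx : x ∈ principalIdeal u)
    (hy : y ∈ principalIdeal u) : φ (x ⊔ y) = φ x ⊔ φ y := by
  rw [sup_eq_smul, sup_eq_smul, map_smul, map_add, map_add, h.map_abs _ (sub_mem hy hx), map_sub]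

theorem map_inf (h : IsCharacter u φ) {x y : X} (hx : x ∈ principalIdeal u)
    (hy : y ∈ principalIdeal u) : φ (x ⊓ y) = φ x ⊓ φ y := by
  rw [inf_eq_smul, inf_eq_smul, map_smul, map_sub, map_add, h.map_abs _ (sub_mem hy hx), map_sub]

theorem mono (h : IsCharacter u φ) {x y : X} (hx : x ∈ principalIdeal u)
    (hy : y ∈ principalIdeal u) (hxy : x ≤ y) : φ x ≤ φ y := by
  rw [← inf_eq_left.2 hxy, h.map_inf hx hy]
  exact inf_le_right

theorem nonneg (h : IsCharacter u φ) {x : X} (hx : x ∈ principalIdeal u) (h0 : 0 ≤ x) :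
    0 ≤ φ x := by
  simpa using h.mono (zero_mem _) hx h0

end IsCharacter

theorem inf_smul_eq_zero {w v : X} (hw : 0 ≤ w) (hv : 0 ≤ v) (h : w ⊓ v = 0) {t : ℝ} (ht : 0 ≤ t) :
    w ⊓ t • v = 0 := by
  refine le_antisymm ?_ (le_inf hw (smul_nonneg ht hv))
  refine (inf_le_inf_left w ?_).trans (inf_nsmul_eq_zero hw hv h ⌈t⌉₊).le
  rw [← Nat.cast_smul_eq_nsmul ℝ]
  exact smul_le_smul_of_nonneg_right (Nat.le_ceil t) hv

open LatticeOrderedAddCommGroup in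
/-- Maximal ideals that do not contain `u` come from characters. -/
theorem exists_isCharacter_of_solid {u : X} (hu : 0 ≤ u) {J : Submodule ℝ X}
    (hJ : IsSolid (J : Set X)) (huJ : u ∉ J) :
    ∃ φ : X →ₗ[ℝ] ℝ, IsCharacter u φ ∧ ∀ x ∈ J, φ x = 0 := by
  obtain ⟨M, hJM, hmax⟩ := zorn_le_nonempty₀
    {M : Submodule ℝ X | IsSolid (M : Set X) ∧ u ∉ M} (by
      intro c hc hchain y hy
      have hdir := hchain.directedOn
      refine ⟨sSup c, ⟨?_, ?_⟩, fun z hz => le_sSup hz⟩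
      · intro x hx y hxy
        rw [SetLike.mem_coe, Submodule.mem_sSup_of_directed ⟨_, hy⟩ hdir] at hx ⊢
        obtain ⟨N, hN, hxN⟩ := hx
        exact ⟨N, hN, (hc hN).1 hxN hxy⟩
      · rw [Submodule.mem_sSup_of_directed ⟨_, hy⟩ hdir]
        rintro ⟨N, hN, huN⟩
        exact (hc hN).2 huN) J ⟨hJ, huJ⟩
  obtain ⟨⟨hsol, huM⟩, hmax⟩ := hmax
  have hmem_abs : ∀ x ∈ M, |x| ∈ M := fun x hx => hsol hx (abs_abs x).le
  have hmem_le : ∀ x ∈ M, ∀ y, |y| ≤ x → y ∈ M := fun x hx y hy =>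
    hsol hx (hy.trans (le_abs_self x))
  -- ideals generated by `M` and further elements
  have hprime : ∀ v w : X, 0 ≤ v → 0 ≤ w → v ⊓ w = 0 → w ∈ principalIdeal u → v ∈ M ∨ w ∈ M := by
    intro v w hv hw hvw ⟨C, hC⟩
    -- If `v ∉ M`, the solid subspace generated by `M` and `v` is strictly larger than `M`, so it
    -- contains `u`. Then `w` lies below an element of `M` plus a multiple of `v`, and disjointness
    -- from `v` leaves only the element of `M`.
    by_contra! hcon
    let N : Submodule ℝ X :=
      { carrier := {x | ∃ m ∈ M, 0 ≤ m ∧ ∃ t : ℝ, 0 ≤ t ∧ |x| ≤ m + t • v}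
        zero_mem' := ⟨0, zero_mem _, le_rfl, 0, le_rfl, by simp⟩
        add_mem' := by
          rintro x y ⟨m, hm, hm0, t, ht, hx⟩ ⟨m', hm', hm0', t', ht', hy⟩
          refine ⟨m + m', add_mem hm hm', add_nonneg hm0 hm0', t + t', add_nonneg ht ht', ?_⟩
          refine (abs_add_le x y).trans ((add_le_add hx hy).trans (le_of_eq ?_))
          module
        smul_mem' := by
          rintro s x ⟨m, hm, hm0, t, ht, hx⟩
          refine ⟨|s| • m, M.smul_mem _ hm, smul_nonneg (abs_nonneg s) hm0, |s| * t,
            mul_nonneg (abs_nonneg s) ht, ?_⟩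
          rw [abs_smul_eq, mul_smul, ← smul_add]
          exact smul_le_smul_of_nonneg_left hx (abs_nonneg s) }
    have hMN : M ≤ N := fun x hx => ⟨|x|, hmem_abs x hx, abs_nonneg x, 0, le_rfl, by simp⟩
    have hvN : v ∈ N := ⟨0, zero_mem _, le_rfl, 1, zero_le_one, by simp [abs_of_nonneg hv]⟩
    have huN : u ∈ N := by
      by_contra huN
      refine hcon.1 (hmax ⟨?_, huN⟩ hMN hvN)
      rintro x ⟨m, hm, hm0, t, ht, hx⟩ y hyx
      exact ⟨m, hm, hm0, t, ht, hyx.trans hx⟩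
    obtain ⟨m, hm, hm0, t, ht, hle⟩ := huN
    rw [abs_of_nonneg hu] at hle
    rw [abs_of_nonneg hw] at hC
    have hC' : w ≤ |C| • m + (|C| * t) • v := by
      refine hC.trans ((smul_le_smul_of_nonneg_right (le_abs_self C) hu).trans ?_)
      rw [mul_smul, ← smul_add]
      exact smul_le_smul_of_nonneg_left hle (abs_nonneg C)
    have := inf_add_le_of_inf_eq_zero (w := w) (smul_nonneg (abs_nonneg C) hm0)
      (inf_smul_eq_zero hw hv (by rwa [inf_comm]) (mul_nonneg (abs_nonneg C) ht))
    rw [inf_eq_left.2 hC'] at this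
    exact hcon.2 (hmem_le _ (M.smul_mem _ hm) _ (by rwa [abs_of_nonneg hw]))
  -- `M` is closed under `u`-uniform limits: the uniform closure `N` is again solid, and it does not
  -- contain `u`, because `ε = 1/2` would give `u ≤ 2m` with `m ∈ M`. Maximality then gives `N ≤ M`.
  have hclosed : ∀ x, (∀ ε : ℝ, 0 < ε → ∃ m ∈ M, |x| ≤ m + ε • u) → x ∈ M := by
    let N : Submodule ℝ X :=
      { carrier := {x | ∀ ε : ℝ, 0 < ε → ∃ m ∈ M, |x| ≤ m + ε • u}
        zero_mem' := fun ε hε => ⟨0, zero_mem _, by simpa using smul_nonneg hε.le hu⟩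
        add_mem' := by
          intro x y hx hy ε hε
          obtain ⟨m, hm, hx⟩ := hx (ε / 2) (half_pos hε)
          obtain ⟨m', hm', hy⟩ := hy (ε / 2) (half_pos hε)
          refine ⟨m + m', add_mem hm hm', ?_⟩
          refine (abs_add_le x y).trans ((add_le_add hx hy).trans (le_of_eq ?_))
          module
        smul_mem' := by
          intro s x hx ε hε
          obtain ⟨m, hm, hx⟩ := hx (ε / (|s| + 1)) (by positivity)
          refine ⟨|s| • m, M.smul_mem _ hm, ?_⟩
          rw [abs_smul_eq]
          refine (smul_le_smul_of_nonneg_left hx (abs_nonneg s)).trans ?_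
          rw [smul_add, smul_smul]
          gcongr
          rw [mul_div_assoc', div_le_iff₀ (by positivity)]
          nlinarith [abs_nonneg s] }
    have hMN : M ≤ N := fun x hx ε hε => ⟨|x|, hmem_abs x hx,
      le_add_of_nonneg_right (smul_nonneg hε.le hu)⟩
    refine fun x hx => hmax (y := N) ⟨?_, ?_⟩ hMN hx
    · intro x hx y hyx ε hε
      obtain ⟨m, hm, h⟩ := hx ε hε
      exact ⟨m, hm, hyx.trans h⟩
    · intro huN
      obtain ⟨m, hm, h⟩ := huN (1 / 2) (by norm_num)
      rw [abs_of_nonneg hu] at h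
      refine huM (hmem_le _ (M.smul_mem 2 hm) u ?_)
      rw [abs_of_nonneg hu]
      have h2 := smul_le_smul_of_nonneg_left (sub_le_iff_le_add.2 h) (zero_le_two (α := ℝ))
      refine le_trans (le_of_eq ?_) h2
      module
  -- Modulo `M` the principal ideal is one-dimensional. By primeness each `t` has `(x - tu)⁺ ∈ M` or
  -- `(x - tu)⁻ ∈ M`; this is a Dedekind cut, and its infimum is the value of `x`.
  have hscalar : ∀ x ∈ principalIdeal u, ∃ t : ℝ, x - t • u ∈ M := by
    intro x hx
    have hp : ∀ t : ℝ, (x - t • u)⁺ ∈ M ∨ (x - t • u)⁻ ∈ M := by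
      intro t
      refine hprime _ _ (posPart_nonneg _) (negPart_nonneg _) (posPart_inf_negPart_eq_zero _) ?_
      have h1 : x - t • u ∈ principalIdeal u :=
        sub_mem hx (Submodule.smul_mem _ _ (self_mem_principalIdeal hu))
      refine mem_principalIdeal_of_abs_le h1 ?_
      rw [abs_of_nonneg (negPart_nonneg _), ← posPart_add_negPart]
      exact le_add_of_nonneg_left (posPart_nonneg _)
    obtain ⟨C, hC⟩ := hx
    let A : Set ℝ := {t | (x - t • u)⁺ ∈ M}
    have hCA : C ∈ A := by
      have : x - C • u ≤ 0 := sub_nonpos.2 ((le_abs_self x).trans hC)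
      change (x - C • u)⁺ ∈ M
      rw [posPart_eq_zero.2 this]
      exact zero_mem _
    have hlow : ∀ t ∈ A, ∀ s, (x - s • u)⁻ ∈ M → s ≤ t := by
      intro t ht s hs
      by_contra! hlt
      refine huM ?_
      have h1 : (s - t) • u ≤ (x - t • u)⁺ + (x - s • u)⁻ := by
        have := add_le_add (le_posPart (x - t • u)) (neg_le_negPart (x - s • u))
        refine le_trans (le_of_eq ?_) this
        module
      have h2 : (s - t) • u ∈ M := hmem_le _ (add_mem ht hs) _ (by
        rwa [abs_of_nonneg (smul_nonneg (sub_nonneg.2 hlt.le) hu)])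
      exact (M.smul_mem_iff (sub_ne_zero.2 hlt.ne')).1 h2
    have hbdd : BddBelow A := by
      refine ⟨-C, fun t ht => hlow t ht _ ?_⟩
      have : 0 ≤ x - (-C) • u := by
        rw [neg_smul, sub_neg_eq_add]
        have := (neg_le_abs x).trans hC
        rwa [neg_le_iff_add_nonneg'] at this
      rw [negPart_eq_zero.2 this]
      exact zero_mem _
    refine ⟨sInf A, hclosed _ fun ε hε => ?_⟩
    obtain ⟨t, htA, ht⟩ := exists_lt_of_csInf_lt ⟨C, hCA⟩ (lt_add_of_pos_right (sInf A) hε)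
    have hs : (x - (sInf A - ε) • u)⁻ ∈ M := by
      refine (hp _).resolve_left fun h => ?_
      have := csInf_le hbdd (show sInf A - ε ∈ A from h)
      linarith
    refine ⟨(x - t • u)⁺ + (x - (sInf A - ε) • u)⁻, add_mem htA hs, ?_⟩
    refine abs_le'.2 ⟨?_, ?_⟩
    · have h1 : x - sInf A • u = (x - t • u) + (t - sInf A) • u := by module
      rw [h1]
      refine add_le_add ?_ (smul_le_smul_of_nonneg_right (by linarith) hu)
      exact (le_posPart _).trans (le_add_of_nonneg_right (negPart_nonneg _))
    · have h1 : -(x - sInf A • u) = -(x - (sInf A - ε) • u) + ε • u := by module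
      rw [h1]
      refine add_le_add_left ?_ _
      exact (neg_le_negPart _).trans (le_add_of_nonneg_left (posPart_nonneg _))
  -- Any linear functional that kills `M` but not `u` will do: on the principal ideal it is
  -- determined by `x ≡ tu` modulo `M`, and solidity of `M` turns this into `|x| ≡ |t|u`.
  obtain ⟨f, hfu, hf⟩ := Submodule.exists_le_ker_of_notMem huM
  have hfM : ∀ x ∈ M, f x = 0 := fun x hx => hf hx
  refine ⟨(f u)⁻¹ • f, ⟨by simp [hfu], fun x hx => ?_⟩, fun x hx => by simp [hfM x (hJM hx)]⟩
  obtain ⟨t, ht⟩ := hscalar x hx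
  have h1 : f x = t * f u := by
    have := hfM _ ht
    rwa [map_sub, map_smul, smul_eq_mul, sub_eq_zero] at this
  have h2 : f |x| = |t| * f u := by
    have h3 : |x| - |t| • u ∈ M := hsol ht (by
      have := abs_abs_sub_abs_le x (t • u)
      rwa [abs_smul_eq, abs_of_nonneg hu] at this)
    have := hfM _ h3
    rwa [map_sub, map_smul, smul_eq_mul, sub_eq_zero] at this
  simp [h1, h2, hfu, mul_comm _ (f u)]

/-- The tent map `s ↦ 1 - |2s - 1|`, with `u` as unit, preserves the order interval from `0` to `u`,
so that it can be iterated in `tentSum`. -/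
theorem tent_mem {u f : X} (h0 : 0 ≤ f) (h1 : f ≤ u) :
    0 ≤ u - |(2 : ℝ) • f - u| ∧ u - |(2 : ℝ) • f - u| ≤ u := by
  refine ⟨sub_nonneg.2 (abs_le'.2 ⟨?_, ?_⟩), sub_le_self _ (abs_nonneg _)⟩
  · have := add_le_add h1 h1
    rw [sub_le_iff_le_add]
    refine le_trans (le_of_eq ?_) this
    module
  · have := add_nonneg h0 h0
    rw [neg_sub, sub_le_self_iff]
    exact smul_nonneg zero_le_two h0

/-- The disjoint complement of a set, as a linear subspace. -/
def bandCompl (A : Set X) : Submodule ℝ X where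
  carrier := disjointCompl A
  zero_mem' := fun y _ => by simp
  add_mem' := by
    intro x y hx hy a ha
    refine le_antisymm ?_ (le_inf (abs_nonneg _) (abs_nonneg _))
    have h := inf_add_le_of_inf_eq_zero (w := |a|) (abs_nonneg x) (by rw [inf_comm]; exact hy a ha)
    calc |x + y| ⊓ |a| ≤ |a| ⊓ (|x| + |y|) := by
          rw [inf_comm]; exact inf_le_inf_left _ (abs_add_le x y)
      _ ≤ |x| ⊓ |a| := le_inf h inf_le_left
      _ = 0 := hx a ha
  smul_mem' := by
    intro t x hx a ha
    rw [abs_smul_eq, inf_comm]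
    exact inf_smul_eq_zero (abs_nonneg _) (abs_nonneg _) (by rw [inf_comm]; exact hx a ha)
      (abs_nonneg t)

theorem mem_bandCompl {A : Set X} {x : X} : x ∈ bandCompl A ↔ ∀ a ∈ A, |x| ⊓ |a| = 0 := Iff.rfl

theorem mem_bandCompl_of_abs_le {A : Set X} {x y : X} (hx : x ∈ bandCompl A) (h : |y| ≤ |x|) :
    y ∈ bandCompl A := fun a ha =>
  le_antisymm ((inf_le_inf_right _ h).trans (hx a ha).le) (le_inf (abs_nonneg _) (abs_nonneg _))

theorem subset_bandCompl_bandCompl (A : Set X) {a : X} (ha : a ∈ A) :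
    a ∈ bandCompl (bandCompl A : Set X) := fun b hb => by
  rw [inf_comm]; exact hb a ha

theorem mem_bandCompl_singleton_of_disjoint {u v x : X} (huv : |u| ⊓ |v| = 0)
    (hx : x ∈ bandCompl (bandCompl {v} : Set X)) : x ∈ bandCompl {u} := by
  rintro _ rfl
  exact hx _ (by rintro _ rfl; exact huv)

variable [HasSolidNorm X]

/-- Characters determine the order of a principal ideal. -/
theorem le_of_forall_isCharacter {u x y : X} (hu : 0 ≤ u) (hx : x ∈ principalIdeal u)
    (hy : y ∈ principalIdeal u) (h : ∀ φ, IsCharacter u φ → φ x ≤ φ y) : x ≤ y := by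
  by_contra hxy
  set w := (x - y) with hw
  have hwI : w ∈ principalIdeal u := sub_mem hx hy
  -- As `εu → 0` in norm and the order is closed, `w ≤ 0` would follow if all these positive parts
  -- vanished.
  obtain ⟨ε, hε, hne⟩ : ∃ ε : ℝ, 0 < ε ∧ (w - ε • u)⁺ ≠ 0 := by
    by_contra! hcon
    refine hxy (sub_nonpos.1 ?_)
    have hlim : Tendsto (fun n : ℕ => (1 / ((n : ℝ) + 1)) • u) atTop (𝓝 0) := by
      simpa using (tendsto_one_div_add_atTop_nhds_zero_nat (𝕜 := ℝ)).smul_const u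
    refine ge_of_tendsto' hlim fun n => ?_
    exact sub_nonpos.1 (posPart_eq_zero.1 (hcon _ (by positivity)))
  have huI : u ∈ principalIdeal u := mem_principalIdeal_of_abs_le_self (abs_of_nonneg hu).le
  have hI : w - ε • u ∈ principalIdeal u := sub_mem hwI (Submodule.smul_mem _ _ huI)
  -- A character that vanishes on `(w - εu)⁻` has `φ w ≥ ε`, against the hypothesis. It exists
  -- because `u` is not in the ideal of this negative part: otherwise `(w - εu)⁺` would lie below a
  -- multiple of an element disjoint from it.
  obtain ⟨φ, hφ, h0⟩ := exists_isCharacter_of_solid hu (J := principalIdeal (w - ε • u)⁻)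
    (fun a ha b hb => mem_principalIdeal_of_abs_le ha hb) (by
      rintro ⟨c, hc⟩
      rw [abs_of_nonneg hu] at hc
      obtain ⟨C, hC⟩ := hI
      have h1 : (w - ε • u)⁺ ≤ (|C| * |c|) • (w - ε • u)⁻ := by
        calc (w - ε • u)⁺ ≤ |w - ε • u| := by
              rw [← posPart_add_negPart]; exact le_add_of_nonneg_right (negPart_nonneg _)
          _ ≤ C • u := hC
          _ ≤ |C| • u := smul_le_smul_of_nonneg_right (le_abs_self C) hu
          _ ≤ |C| • (|c| • (w - ε • u)⁻) := smul_le_smul_of_nonneg_left (hc.trans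
              (smul_le_smul_of_nonneg_right (le_abs_self c) (negPart_nonneg _))) (abs_nonneg C)
          _ = _ := by rw [mul_smul]
      have h2 := inf_smul_eq_zero (posPart_nonneg _) (negPart_nonneg _)
        (posPart_inf_negPart_eq_zero (w - ε • u)) (mul_nonneg (abs_nonneg C) (abs_nonneg c))
      rw [inf_eq_left.2 h1] at h2
      exact hne h2)
  have h1 : φ (w - ε • u)⁻ = 0 := h0 _ (mem_principalIdeal_of_abs_le_self
    (abs_of_nonneg (negPart_nonneg _)).le)
  have h2 : 0 ≤ φ (w - ε • u) := by
    have h3 := posPart_sub_negPart (w - ε • u)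
    have h4 : (w - ε • u)⁺ ∈ principalIdeal u := sup_mem_principalIdeal hI (zero_mem _)
    rw [← h3, map_sub, h1, sub_zero]
    exact hφ.nonneg h4 (posPart_nonneg _)
  have h5 := h φ hφ
  rw [map_sub, map_smul, hφ.map_unit, hw, map_sub, smul_eq_mul] at h2
  linarith

theorem eq_of_forall_isCharacter {u x y : X} (hu : 0 ≤ u) (hx : x ∈ principalIdeal u)
    (hy : y ∈ principalIdeal u) (h : ∀ φ, IsCharacter u φ → φ x = φ y) : x = y :=
  le_antisymm (le_of_forall_isCharacter hu hx hy fun φ hφ => (h φ hφ).le)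
    (le_of_forall_isCharacter hu hy hx fun φ hφ => (h φ hφ).ge)

end Characters

/-! ### The product on a principal ideal -/

section Multiplication

variable {X : Type*} [NormedAddCommGroup X] [NormedSpace ℝ X] [Lattice X] [IsOrderedAddMonoid X]
  [IsOrderedModule ℝ X]

theorem IsCharacter.abs_apply_le {u x : X} {c : ℝ} {φ : X →ₗ[ℝ] ℝ} (hφ : IsCharacter u φ)
    (hu : 0 ≤ u) (h : |x| ≤ c • u) : |φ x| ≤ c := by
  have hx : x ∈ principalIdeal u := ⟨c, h⟩
  have := hφ.mono (abs_mem_principalIdeal hx)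
    (Submodule.smul_mem _ c (self_mem_principalIdeal hu)) h
  rwa [hφ.map_abs _ hx, map_smul, hφ.map_unit, smul_eq_mul, mul_one] at this

/-- Approximations of `f - f²` by piecewise linear functions of `f`, where `u` is the unit. -/
noncomputable def tentSum {X : Type*} [NormedAddCommGroup X] [NormedSpace ℝ X] [Lattice X]
    (u : X) : ℕ → X → X
  | 0, _ => 0
  | n + 1, f => (1 / 4 : ℝ) • (u - |(2 : ℝ) • f - u|) +
      (1 / 4 : ℝ) • tentSum u n (u - |(2 : ℝ) • f - u|)

theorem tentSum_mem {u f : X} (n : ℕ) (h0 : 0 ≤ f) (h1 : f ≤ u) :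
    tentSum u n f ∈ principalIdeal u := by
  induction n generalizing f with
  | zero => exact zero_mem _
  | succ n ih =>
    have ht := tent_mem h0 h1
    exact add_mem (Submodule.smul_mem _ _ (mem_principalIdeal_of_nonneg_of_le ht.1 ht.2))
      (Submodule.smul_mem _ _ (ih ht.1 ht.2))

theorem IsVectorSublattice.tentSum_mem {X : Type*} [NormedAddCommGroup X] [NormedSpace ℝ X]
    [Lattice X] {Y : Submodule ℝ X} (hY : IsVectorSublattice Y) {u f : X} (n : ℕ) (hu : u ∈ Y)
    (hf : f ∈ Y) : tentSum u n f ∈ Y := by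
  induction n generalizing f with
  | zero => exact zero_mem _
  | succ n ih =>
    have ht : u - |(2 : ℝ) • f - u| ∈ Y :=
      sub_mem hu (hY.abs_mem (sub_mem (Y.smul_mem _ hf) hu))
    exact add_mem (Y.smul_mem _ ht) (Y.smul_mem _ (ih ht))

/-- With `T = 1 - |2s - 1|`, the polynomial `p(s) = s - s²` satisfies `p(s) = T/4 + p(T)/4`. Each
step of the recursion therefore divides the error by 4. -/
theorem IsCharacter.abs_tentSum_sub_le {u f : X} {φ : X →ₗ[ℝ] ℝ} (hφ : IsCharacter u φ) (n : ℕ)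
    (h0 : 0 ≤ f) (h1 : f ≤ u) : |φ (tentSum u n f) - (φ f - φ f ^ 2)| ≤ (1 / 4) ^ n := by
  have hu : 0 ≤ u := h0.trans h1
  induction n generalizing f with
  | zero =>
    have hf := mem_principalIdeal_of_nonneg_of_le h0 h1
    have h2 := hφ.nonneg hf h0
    have h3 := hφ.mono hf (self_mem_principalIdeal hu) h1
    rw [hφ.map_unit] at h3
    rw [tentSum, map_zero, pow_zero, abs_le]
    constructor <;> nlinarith
  | succ n ih =>
    have ht := tent_mem h0 h1
    have h2 := ih ht.1 ht.2
    have h3 : φ (u - |(2 : ℝ) • f - u|) = 1 - |2 * φ f - 1| := by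
      rw [map_sub, hφ.map_unit, hφ.map_abs, map_sub, map_smul, hφ.map_unit, smul_eq_mul]
      exact sub_mem (Submodule.smul_mem _ _ (mem_principalIdeal_of_nonneg_of_le h0 h1))
        (self_mem_principalIdeal hu)
    rw [tentSum, map_add, map_smul, map_smul, smul_eq_mul, smul_eq_mul]
    rw [h3] at h2 ⊢
    have h4 := sq_abs (2 * φ f - 1)
    have h5 : 1 / 4 * (1 - |2 * φ f - 1|) +
        1 / 4 * φ (tentSum u n (u - |(2 : ℝ) • f - u|)) - (φ f - φ f ^ 2) =
        1 / 4 * (φ (tentSum u n (u - |(2 : ℝ) • f - u|)) -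
          (1 - |2 * φ f - 1| - (1 - |2 * φ f - 1|) ^ 2)) := by
      linear_combination (-1 / 4) * h4
    rw [h5, abs_mul, pow_succ' _ n, abs_of_nonneg (show (0 : ℝ) ≤ 1 / 4 by norm_num)]
    exact mul_le_mul_of_nonneg_left h2 (show (0 : ℝ) ≤ 1 / 4 by norm_num)

variable [HasSolidNorm X]

theorem abs_le_smul_of_forall_isCharacter {u x : X} {c : ℝ} (hu : 0 ≤ u)
    (hx : x ∈ principalIdeal u) (h : ∀ φ, IsCharacter u φ → |φ x| ≤ c) : |x| ≤ c • u := by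
  refine le_of_forall_isCharacter hu (abs_mem_principalIdeal hx)
    (Submodule.smul_mem _ _ (self_mem_principalIdeal hu)) fun φ hφ => ?_
  rw [hφ.map_abs _ hx, map_smul, hφ.map_unit, smul_eq_mul, mul_one]
  exact h φ hφ

variable [CompleteSpace X]

/-- Bounds at characters become order bounds by multiples of `u`, hence norm bounds, so `tentSum u n
f` is Cauchy and `w` is its limit. The approximants are lattice expressions in `u` and `f`, which is
why one `w` serves every closed sublattice `Y`. -/
theorem exists_sub_sq {u f : X} (h0 : 0 ≤ f) (h1 : f ≤ u) :
    ∃ w ∈ principalIdeal u, (∀ φ, IsCharacter u φ → φ w = φ f - φ f ^ 2) ∧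
      ∀ Y : Submodule ℝ X, IsClosed (Y : Set X) → IsVectorSublattice Y → u ∈ Y → f ∈ Y → w ∈ Y := by
  have hu : 0 ≤ u := h0.trans h1
  have hdiff : ∀ N n m, N ≤ n → N ≤ m →
      |tentSum u n f - tentSum u m f| ≤ (2 * (1 / 4 : ℝ) ^ N) • u := by
    intro N n m hn hm
    refine abs_le_smul_of_forall_isCharacter hu
      (sub_mem (tentSum_mem n h0 h1) (tentSum_mem m h0 h1)) fun φ hφ => ?_
    have a1 := hφ.abs_tentSum_sub_le n h0 h1
    have a2 := hφ.abs_tentSum_sub_le m h0 h1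
    have b1 : (1 / 4 : ℝ) ^ n ≤ (1 / 4) ^ N := pow_le_pow_of_le_one (by norm_num) (by norm_num) hn
    have b2 : (1 / 4 : ℝ) ^ m ≤ (1 / 4) ^ N := pow_le_pow_of_le_one (by norm_num) (by norm_num) hm
    rw [map_sub]
    rw [abs_le] at a1 a2 ⊢
    constructor <;> linarith
  have hpow : Tendsto (fun N : ℕ => 2 * (1 / 4 : ℝ) ^ N) atTop (𝓝 0) := by
    simpa using (tendsto_pow_atTop_nhds_zero_of_lt_one (r := (1 / 4 : ℝ)) (by norm_num)
      (by norm_num)).const_mul 2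
  have hcau : CauchySeq fun n => tentSum u n f := by
    refine cauchySeq_of_le_tendsto_0 (fun N : ℕ => (2 * (1 / 4 : ℝ) ^ N) * ‖u‖) ?_
      (by simpa using hpow.mul_const ‖u‖)
    intro n m N hn hm
    rw [dist_eq_norm]
    refine (norm_le_norm_of_abs_le_abs ((hdiff N n m hn hm).trans (le_abs_self _))).trans ?_
    rw [norm_smul, Real.norm_of_nonneg (by positivity)]
  obtain ⟨w, hw⟩ := cauchySeq_tendsto_of_complete hcau
  have hwn : ∀ N, |tentSum u N f - w| ≤ (2 * (1 / 4 : ℝ) ^ N) • u := fun N =>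
    le_of_tendsto ((tendsto_const_nhds.sub hw).sup_nhds (tendsto_const_nhds.sub hw).neg)
      ((eventually_ge_atTop N).mono fun m hm => hdiff N N m le_rfl hm)
  refine ⟨w, ?_, fun φ hφ => ?_, fun Y hYc hY huY hfY =>
    hYc.mem_of_tendsto hw (Eventually.of_forall fun n => hY.tentSum_mem n huY hfY)⟩
  · have : w = tentSum u 0 f - (tentSum u 0 f - w) := by abel
    rw [this]
    exact sub_mem (tentSum_mem 0 h0 h1) ⟨_, hwn 0⟩
  · have h2 : ∀ N, |φ w - (φ f - φ f ^ 2)| ≤ 2 * (1 / 4 : ℝ) ^ N + 2 * (1 / 4 : ℝ) ^ N := by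
      intro N
      have a1 := hφ.abs_tentSum_sub_le N h0 h1
      have a2 := hφ.abs_apply_le hu (hwn N)
      have : (0 : ℝ) ≤ (1 / 4) ^ N := by positivity
      rw [map_sub] at a2
      rw [abs_le] at a1 a2 ⊢
      constructor <;> linarith
    have h3 := ge_of_tendsto' (hpow.add hpow) h2
    rw [add_zero] at h3
    exact sub_eq_zero.1 (abs_nonpos_iff.1 h3)

/-- Rescale `f` affinely to `g = (f + Cu)/(2C)`, which lies between `0` and `u`. From `f = C(2g -
u)` one gets `f² = C²u - 4C²(g - g²)`. -/
theorem exists_sq {u f : X} (hu : 0 ≤ u) (hf : f ∈ principalIdeal u) :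
    ∃ w ∈ principalIdeal u, (∀ φ, IsCharacter u φ → φ w = φ f ^ 2) ∧
      ∀ Y : Submodule ℝ X, IsClosed (Y : Set X) → IsVectorSublattice Y → u ∈ Y → f ∈ Y → w ∈ Y := by
  obtain ⟨c, hc⟩ := id hf
  set C : ℝ := |c| + 1 with hC
  have hC0 : 0 < C := by positivity
  have hfC : |f| ≤ C • u := hc.trans
    (smul_le_smul_of_nonneg_right ((le_abs_self c).trans (by linarith)) hu)
  set g : X := (2 * C)⁻¹ • (f + C • u) with hg
  have hg0 : 0 ≤ g := by
    refine smul_nonneg (by positivity) ?_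
    have := (neg_le_abs f).trans hfC
    rwa [neg_le_iff_add_nonneg'] at this
  have hg1 : g ≤ u := by
    rw [hg, inv_smul_le_iff_of_pos (by positivity)]
    have := add_le_add_left ((le_abs_self f).trans hfC) (C • u)
    refine this.trans (le_of_eq ?_)
    module
  obtain ⟨w, hw, hφw, hYw⟩ := exists_sub_sq hg0 hg1
  have huI := self_mem_principalIdeal hu
  refine ⟨(C ^ 2) • u - (4 * C ^ 2) • w, ?_, ?_, ?_⟩
  · exact sub_mem (Submodule.smul_mem _ _ huI) (Submodule.smul_mem _ _ hw)
  · intro φ hφ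
    have h1 : φ g = (2 * C)⁻¹ * (φ f + C) := by
      rw [hg, map_smul, map_add, map_smul, hφ.map_unit, smul_eq_mul, smul_eq_mul, mul_one]
    rw [map_sub, map_smul, map_smul, hφw φ hφ, h1, hφ.map_unit]
    simp only [smul_eq_mul]
    field_simp
    ring
  · intro Y hYc hY huY hfY
    exact sub_mem (Y.smul_mem _ huY) (Y.smul_mem _ (hYw Y hYc hY huY
      (Y.smul_mem _ (add_mem hfY (Y.smul_mem _ huY)))))

/-- A principal ideal of a Banach lattice is closed under the multiplication that has the generator
as its unit. -/
theorem exists_mul {u f g : X} (hu : 0 ≤ u) (hf : f ∈ principalIdeal u)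
    (hg : g ∈ principalIdeal u) :
    ∃ w ∈ principalIdeal u, (∀ φ, IsCharacter u φ → φ w = φ f * φ g) ∧
      ∀ Y : Submodule ℝ X, IsClosed (Y : Set X) → IsVectorSublattice Y → u ∈ Y → f ∈ Y → g ∈ Y →
        w ∈ Y := by
  obtain ⟨v, hv, hφv, hYv⟩ := exists_sq hu (add_mem hf hg)
  obtain ⟨w, hw, hφw, hYw⟩ := exists_sq hu (sub_mem hf hg)
  refine ⟨(1 / 4 : ℝ) • (v - w), Submodule.smul_mem _ _ (sub_mem hv hw), fun φ hφ => ?_,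
    fun Y hYc hY huY hfY hgY => Y.smul_mem _
      (sub_mem (hYv Y hYc hY huY (add_mem hfY hgY)) (hYw Y hYc hY huY (sub_mem hfY hgY)))⟩
  rw [map_smul, map_sub, hφv φ hφ, hφw φ hφ, map_add, map_sub, smul_eq_mul]
  ring

end Multiplication

/-! ### Characters, products and signs on the complexification -/

namespace Complexification

section Functionals

variable {X : Type*} [NormedAddCommGroup X]

theorem ofReal_sub (x y : X) : ofReal (x - y) = ofReal x - ofReal y := by
  ext <;> simp [ofReal]

theorem ofReal_add (x y : X) : ofReal (x + y) = ofReal x + ofReal y := by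
  ext <;> simp [ofReal]


variable [NormedSpace ℝ X]

theorem eq_ofReal_add (z : Complexification X) :
    z = ofReal z.re + Complex.I • ofReal z.im := by
  ext <;> simp [ofReal]

/-- The complex linear extension of a real linear functional. -/
noncomputable def extendFunctional (φ : X →ₗ[ℝ] ℝ) : Complexification X →ₗ[ℂ] ℂ where
  toFun z := ⟨φ z.re, φ z.im⟩
  map_add' z w := by apply Complex.ext <;> simp
  map_smul' c z := by apply Complex.ext <;> simp

@[simp] theorem extendFunctional_re (φ : X →ₗ[ℝ] ℝ) (z : Complexification X) :
    (extendFunctional φ z).re = φ z.re := rfl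
@[simp] theorem extendFunctional_im (φ : X →ₗ[ℝ] ℝ) (z : Complexification X) :
    (extendFunctional φ z).im = φ z.im := rfl

@[simp] theorem extendFunctional_ofReal (φ : X →ₗ[ℝ] ℝ) (x : X) :
    extendFunctional φ (ofReal x) = (φ x : ℂ) := by
  apply Complex.ext <;> simp [ofReal]

end Functionals

section Modulus

variable {X : Type*} [NormedAddCommGroup X] [NormedSpace ℝ X] [Lattice X] [IsOrderedAddMonoid X]
  [IsOrderedModule ℝ X] [HasSolidNorm X] [CompleteSpace X]

theorem modulus_le_abs_add_abs (z : Complexification X) : modulus z ≤ |z.re| + |z.im| := by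
  refine modulus_le fun θ => add_le_add ?_ ?_
  · refine (smul_le_abs_smul _ _).trans ?_
    simpa using smul_le_smul_of_nonneg_right (Real.abs_cos_le_one θ) (abs_nonneg z.re)
  · refine (smul_le_abs_smul _ _).trans ?_
    simpa using smul_le_smul_of_nonneg_right (Real.abs_sin_le_one θ) (abs_nonneg z.im)

theorem abs_modulus (z : Complexification X) : |modulus z| = modulus z :=
  abs_of_nonneg (modulus_nonneg z)

theorem modulus_mem_principalIdeal {u : X} {z : Complexification X} :
    modulus z ∈ principalIdeal u ↔ z.re ∈ principalIdeal u ∧ z.im ∈ principalIdeal u := by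
  refine ⟨fun h => ⟨?_, ?_⟩, fun h => ?_⟩
  · exact mem_principalIdeal_of_abs_le h (by rw [abs_modulus]; exact abs_re_le_modulus z)
  · exact mem_principalIdeal_of_abs_le h (by rw [abs_modulus]; exact abs_im_le_modulus z)
  · refine mem_principalIdeal_of_abs_le
      (add_mem (abs_mem_principalIdeal h.1) (abs_mem_principalIdeal h.2)) ?_
    rw [abs_modulus]
    exact (modulus_le_abs_add_abs z).trans (le_abs_self _)

theorem mem_ideal₀_iff {y z : Complexification X} :
    z ∈ ideal₀ y ↔ modulus z ∈ principalIdeal (modulus y) := by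
  constructor
  · rintro ⟨n, hn⟩
    exact ⟨n, by rwa [abs_modulus, Nat.cast_smul_eq_nsmul]⟩
  · rintro ⟨c, hc⟩
    refine ⟨⌈c⌉₊, ?_⟩
    rw [abs_modulus] at hc
    rw [← Nat.cast_smul_eq_nsmul ℝ]
    exact hc.trans (smul_le_smul_of_nonneg_right (Nat.le_ceil c) (modulus_nonneg y))

/-- The modulus is an infinite supremum, which a lattice homomorphism need not respect. For `≤`,
compare `z` with `c • u`, where `c` is the value of `φ` at `z`: both parts of the difference are
killed by `φ`. For `≥`, rotate by the argument of `c`. -/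
theorem modulus_map_character {u : X} {φ : X →ₗ[ℝ] ℝ} (hφ : IsCharacter u φ) (hu : 0 ≤ u)
    {z : Complexification X} (hz : modulus z ∈ principalIdeal u) :
    φ (modulus z) = ‖extendFunctional φ z‖ := by
  obtain ⟨hre, him⟩ := modulus_mem_principalIdeal.1 hz
  have huI := self_mem_principalIdeal hu
  set c := extendFunctional φ z with hc
  apply le_antisymm
  · have e1 : (z - c • ofReal u).re = z.re - φ z.re • u := by simp [ofReal, hc]
    have e2 : (z - c • ofReal u).im = z.im - φ z.im • u := by simp [ofReal, hc]
    have h1 : modulus z ≤ (|z.re - φ z.re • u| + |z.im - φ z.im • u|) + ‖c‖ • u := by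
      have := modulus_add_le (z - c • ofReal u) (c • ofReal u)
      rw [sub_add_cancel, modulus_smul, modulus_ofReal, abs_of_nonneg hu] at this
      refine this.trans (add_le_add_left ((modulus_le_abs_add_abs _).trans (le_of_eq ?_)) _)
      rw [e1, e2]
    have m1 := sub_mem hre (Submodule.smul_mem _ (φ z.re) huI)
    have m2 := sub_mem him (Submodule.smul_mem _ (φ z.im) huI)
    have h2 := hφ.mono hz (add_mem (add_mem (abs_mem_principalIdeal m1) (abs_mem_principalIdeal m2))
      (Submodule.smul_mem _ ‖c‖ huI)) h1
    simpa [hφ.map_abs _ m1, hφ.map_abs _ m2, hφ.map_unit] using h2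
  · have h1 := hφ.mono (add_mem (Submodule.smul_mem _ _ hre) (Submodule.smul_mem _ _ him)) hz
      (rot_le_modulus z c.arg)
    rw [map_add, map_smul, map_smul, smul_eq_mul, smul_eq_mul, ← extendFunctional_re,
      ← extendFunctional_im, ← hc, ← Complex.norm_mul_cos_arg c, ← Complex.norm_mul_sin_arg c] at h1
    have h2 := Real.cos_sq_add_sin_sq c.arg
    have : ‖c‖ = Real.cos c.arg * (‖c‖ * Real.cos c.arg) +
        Real.sin c.arg * (‖c‖ * Real.sin c.arg) := by
      linear_combination -‖c‖ * h2
    rw [this]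
    simpa using h1

theorem eq_of_forall_extendFunctional {u : X} (hu : 0 ≤ u) {z w : Complexification X}
    (hz : modulus z ∈ principalIdeal u) (hw : modulus w ∈ principalIdeal u)
    (h : ∀ φ, IsCharacter u φ → extendFunctional φ z = extendFunctional φ w) : z = w := by
  obtain ⟨hz1, hz2⟩ := modulus_mem_principalIdeal.1 hz
  obtain ⟨hw1, hw2⟩ := modulus_mem_principalIdeal.1 hw
  ext
  · exact eq_of_forall_isCharacter hu hz1 hw1 fun φ hφ => congrArg Complex.re (h φ hφ)
  · exact eq_of_forall_isCharacter hu hz2 hw2 fun φ hφ => congrArg Complex.im (h φ hφ)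

theorem exists_complex_mul {u : X} (hu : 0 ≤ u) {z w : Complexification X}
    (hz : modulus z ∈ principalIdeal u) (hw : modulus w ∈ principalIdeal u) :
    ∃ v : Complexification X, modulus v ∈ principalIdeal u ∧
      (∀ φ, IsCharacter u φ →
        extendFunctional φ v = extendFunctional φ z * extendFunctional φ w) ∧
      ∀ Y : Submodule ℝ X, IsClosed (Y : Set X) → IsVectorSublattice Y → u ∈ Y →
        z.re ∈ Y → z.im ∈ Y → w.re ∈ Y → w.im ∈ Y → v.re ∈ Y ∧ v.im ∈ Y := by
  obtain ⟨hz1, hz2⟩ := modulus_mem_principalIdeal.1 hz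
  obtain ⟨hw1, hw2⟩ := modulus_mem_principalIdeal.1 hw
  obtain ⟨a, ha, hφa, hYa⟩ := exists_mul hu hz1 hw1
  obtain ⟨b, hb, hφb, hYb⟩ := exists_mul hu hz2 hw2
  obtain ⟨c, hc, hφc, hYc⟩ := exists_mul hu hz1 hw2
  obtain ⟨d, hd, hφd, hYd⟩ := exists_mul hu hz2 hw1
  refine ⟨⟨a - b, c + d⟩, modulus_mem_principalIdeal.2 ⟨sub_mem ha hb, add_mem hc hd⟩,
    fun φ hφ => ?_, fun Y hY hYs hu h1 h2 h3 h4 => ⟨sub_mem (hYa Y hY hYs hu h1 h3)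
      (hYb Y hY hYs hu h2 h4), add_mem (hYc Y hY hYs hu h1 h4) (hYd Y hY hYs hu h2 h3)⟩⟩
  apply Complex.ext
  · simp [hφa φ hφ, hφb φ hφ]
  · simp [hφc φ hφ, hφd φ hφ]

/-- Multiplication by `y`, where `|y|` is the unit. -/
theorem exists_mul_operator (y : Complexification X) :
    ∃ T : ideal₀ y →ₗ[ℂ] ideal₀ y, ∀ z φ, IsCharacter (modulus y) φ →
      extendFunctional φ (T z) = extendFunctional φ y * extendFunctional φ z := by
  have hu := modulus_nonneg y
  have hmem : ∀ z : ideal₀ y, modulus (z : Complexification X) ∈ principalIdeal (modulus y) :=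
    fun z => mem_ideal₀_iff.1 z.2
  have hy := self_mem_principalIdeal hu
  have h : ∀ z : ideal₀ y, ∃ v : ideal₀ y, ∀ φ, IsCharacter (modulus y) φ →
      extendFunctional φ v = extendFunctional φ y * extendFunctional φ z := fun z => by
    obtain ⟨v, hv, hφv, -⟩ := exists_complex_mul hu hy (hmem z)
    exact ⟨⟨v, mem_ideal₀_iff.2 hv⟩, hφv⟩
  choose T hT using h
  have hext : ∀ v w : ideal₀ y, (∀ φ, IsCharacter (modulus y) φ →
      extendFunctional φ (v : Complexification X) = extendFunctional φ w) → v = w := fun v w h =>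
    Subtype.ext (eq_of_forall_extendFunctional hu (hmem v) (hmem w) h)
  refine ⟨{ toFun := T, map_add' := fun z w => hext _ _ fun φ hφ => ?_,
            map_smul' := fun c z => hext _ _ fun φ hφ => ?_ }, hT⟩
  · simp only [hT _ φ hφ, Submodule.coe_add, map_add, mul_add]
  · simp only [hT _ φ hφ, Submodule.coe_smul, map_smul, smul_eq_mul, RingHom.id_apply]
    ring

end Modulus

section Sign

variable {X : Type*} [NormedAddCommGroup X] [NormedSpace ℝ X] [Lattice X] [IsOrderedAddMonoid X]
  [IsOrderedModule ℝ X] [HasSolidNorm X] [CompleteSpace X]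

theorem norm_eq_of_modulus_eq {z w : Complexification X} (h : modulus z = modulus w) :
    ‖z‖ = ‖w‖ := by
  rw [norm_def, norm_def, h]

theorem modulus_neg (z : Complexification X) : modulus (-z) = modulus z := by
  simpa using modulus_smul (-1 : ℂ) z

theorem modulus_sub_comm (z w : Complexification X) : modulus (z - w) = modulus (w - z) := by
  rw [← modulus_neg, neg_sub]

theorem abs_modulus_sub_le (z w : Complexification X) :
    |modulus z - modulus w| ≤ modulus (z - w) := by
  have h : ∀ z w : Complexification X, modulus z - modulus w ≤ modulus (z - w) := fun z w => by
    rw [sub_le_iff_le_add]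
    simpa using modulus_add_le (z - w) w
  refine abs_le'.2 ⟨h z w, ?_⟩
  rw [neg_sub, modulus_sub_comm]
  exact h w z

theorem continuous_modulus : Continuous (modulus : Complexification X → X) := by
  refine (LipschitzWith.of_dist_le_mul (K := 1) fun z w => ?_).continuous
  rw [NNReal.coe_one, one_mul, dist_eq_norm, dist_eq_norm, norm_def]
  refine norm_le_norm_of_abs_le_abs ?_
  rw [abs_modulus]
  exact abs_modulus_sub_le z w

theorem norm_re_le (z : Complexification X) : ‖z.re‖ ≤ ‖z‖ := by
  refine norm_le_norm_of_abs_le_abs ?_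
  rw [abs_modulus]
  exact abs_re_le_modulus z

theorem norm_im_le (z : Complexification X) : ‖z.im‖ ≤ ‖z‖ := by
  refine norm_le_norm_of_abs_le_abs ?_
  rw [abs_modulus]
  exact abs_im_le_modulus z

theorem norm_le_add (z : Complexification X) : ‖z‖ ≤ ‖z.re‖ + ‖z.im‖ := by
  rw [norm_def, ← norm_abs_eq_norm z.re, ← norm_abs_eq_norm z.im]
  refine (norm_le_norm_of_abs_le_abs ?_).trans (norm_add_le _ _)
  rw [abs_modulus]
  exact (modulus_le_abs_add_abs z).trans (le_abs_self _)

theorem norm_ofReal (x : X) : ‖ofReal x‖ = ‖x‖ := by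
  rw [norm_def, modulus_ofReal, norm_abs_eq_norm]

theorem continuous_ofReal : Continuous (ofReal : X → Complexification X) := by
  refine (LipschitzWith.of_dist_le_mul (K := 1) fun x y => ?_).continuous
  rw [NNReal.coe_one, one_mul, dist_eq_norm, dist_eq_norm, ← ofReal_sub, norm_ofReal]

instance : CompleteSpace (Complexification X) := by
  refine Metric.complete_of_cauchySeq_tendsto fun z hz => ?_
  have key : ∀ f : Complexification X → X, (∀ z w, f (z - w) = f z - f w) →
      (∀ z, ‖f z‖ ≤ ‖z‖) → ∃ x, Tendsto (fun n => f (z n)) atTop (𝓝 x) := by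
    intro f hf hn
    refine cauchySeq_tendsto_of_complete ?_
    have hl : LipschitzWith 1 f := LipschitzWith.of_dist_le_mul fun z w => by
      rw [NNReal.coe_one, one_mul, dist_eq_norm, dist_eq_norm, ← hf]
      exact hn _
    exact hz.map hl.uniformContinuous
  obtain ⟨x, hx⟩ := key re sub_re norm_re_le
  obtain ⟨y, hy⟩ := key im sub_im norm_im_le
  refine ⟨⟨x, y⟩, tendsto_iff_norm_sub_tendsto_zero.2 ?_⟩
  refine squeeze_zero (fun n => norm_nonneg _) (fun n => norm_le_add _) ?_
  simpa using (tendsto_iff_norm_sub_tendsto_zero.1 hx).add (tendsto_iff_norm_sub_tendsto_zero.1 hy)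

theorem norm_extendFunctional_unit {y : Complexification X} {φ : X →ₗ[ℝ] ℝ}
    (hφ : IsCharacter (modulus y) φ) : ‖extendFunctional φ y‖ = 1 := by
  have hu := modulus_nonneg y
  rw [← modulus_map_character hφ hu (self_mem_principalIdeal hu), hφ.map_unit]

/-- The multiplication by the sign of `y` on the closed ideal generated by `y`. -/
theorem exists_sign_operator (y : Complexification X) :
    ∃ S : closedIdeal y →L[ℂ] closedIdeal y,
      (∀ z : closedIdeal y, modulus (S z : Complexification X) = modulus (z : Complexification X)) ∧
      ∀ z : closedIdeal y, (z : Complexification X) ∈ ideal₀ y →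
        (S z : Complexification X) ∈ ideal₀ y ∧ ∀ φ, IsCharacter (modulus y) φ →
        extendFunctional φ (S z : Complexification X) =
          extendFunctional φ y * extendFunctional φ (z : Complexification X) := by
  have hu := modulus_nonneg y
  obtain ⟨T, hT⟩ := exists_mul_operator y
  have hmod : ∀ z : ideal₀ y, modulus (T z : Complexification X) =
      modulus (z : Complexification X) := fun z => by
    have hz := mem_ideal₀_iff.1 z.2
    have hTz := mem_ideal₀_iff.1 (T z).2
    refine eq_of_forall_isCharacter hu hTz hz fun φ hφ => ?_
    rw [modulus_map_character hφ hu hz, modulus_map_character hφ hu hTz, hT z φ hφ, norm_mul,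
      norm_extendFunctional_unit hφ, one_mul]
  let ι : ideal₀ y →ₗ[ℂ] closedIdeal y := Submodule.inclusion (ideal₀ y).le_topologicalClosure
  have hι : DenseRange ι := by
    intro z
    rw [closure_subtype]
    have hz : (z : Complexification X) ∈ closure (ideal₀ y : Set (Complexification X)) := by
      rw [← Submodule.topologicalClosure_coe]; exact z.2
    refine closure_mono ?_ hz
    intro w hw
    exact ⟨ι ⟨w, hw⟩, ⟨_, rfl⟩, rfl⟩
  have : CompleteSpace (closedIdeal y) :=
    ((ideal₀ y).isClosed_topologicalClosure).completeSpace_coe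
  have hnorm : ∀ z, ‖(ι ∘ₗ T) z‖ ≤ 1 * ‖ι z‖ := fun z => by
    rw [one_mul]
    exact (norm_eq_of_modulus_eq (hmod z)).le
  -- Multiplication by `y` preserves moduli, since `y` has modulus 1 at each character. It is thus
  -- isometric and extends from the dense ideal; the modulus identity passes to the limit.
  let S := (ι ∘ₗ T).extendOfNorm ι
  have hS : ∀ z, S (ι z) = ι (T z) := LinearMap.extendOfNorm_eq hι ⟨1, hnorm⟩
  refine ⟨S, fun z => ?_, fun z hz => ?_⟩
  · refine hι.induction_on (p := fun z : closedIdeal y =>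
      modulus (S z : Complexification X) = modulus (z : Complexification X)) z ?_ fun a => ?_
    · exact isClosed_eq (continuous_modulus.comp (continuous_subtype_val.comp S.continuous))
        (continuous_modulus.comp continuous_subtype_val)
    · rw [hS]
      exact hmod a
  · have : z = ι ⟨z, hz⟩ := rfl
    rw [this, hS]
    exact ⟨(T _).2, hT _⟩

/-- Existence alone justifies the choice made in `sign`. Uniqueness of the operator is never needed,
because `eq_lacey` determines `b(x,y)` by moduli. -/
theorem isSign_sign (y : Complexification X) : IsSign y (sign y) := by
  refine Classical.epsilon_spec (p := IsSign y) ?_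
  obtain ⟨S, hS, hφ⟩ := exists_sign_operator y
  have hu := modulus_nonneg y
  have hy := self_mem_principalIdeal hu
  refine ⟨S, hS, ?_⟩
  have hmem : (modulusIn y : Complexification X) ∈ ideal₀ y := by
    rw [mem_ideal₀_iff, modulusIn, modulus_ofReal, abs_modulus]
    exact hy
  obtain ⟨h1, h2⟩ := hφ _ hmem
  refine eq_of_forall_extendFunctional hu (mem_ideal₀_iff.1 h1) hy fun φ hφ => ?_
  refine (h2 φ hφ).trans ?_
  simp [modulusIn, hφ.map_unit]

theorem modulus_lacey (x y : Complexification X) : modulus (lacey x y) = modulus x ⊓ modulus y := by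
  rw [lacey, (isSign_sign y).1, infIn, modulus_ofReal,
    abs_of_nonneg (le_inf (modulus_nonneg x) (modulus_nonneg y))]

theorem modulus_sub_lacey (x y : Complexification X) :
    modulus (y - lacey x y) = modulus y - modulus x ⊓ modulus y := by
  have h : y - lacey x y = sign y (modulusIn y - infIn x y) := by
    rw [map_sub, Submodule.coe_sub, (isSign_sign y).2, lacey]
  rw [h, (isSign_sign y).1, Submodule.coe_sub, modulusIn, infIn, ← ofReal_sub, modulus_ofReal,
    abs_of_nonneg (sub_nonneg.2 inf_le_right)]

/-- Equality in the triangle inequality `‖η‖ ≤ ‖α‖ + ‖η - α‖` forces `α` onto the segment from `0`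
to `η`. -/
theorem _root_.Complex.eq_smul_of_norm_eq {η α : ℂ} {t : ℝ} (hη : ‖η‖ = 1) (h1 : ‖α‖ = t)
    (h2 : ‖η - α‖ = 1 - t) : α = t * η := by
  have e1 : ‖η‖ ^ 2 = η.re * η.re + η.im * η.im := by
    rw [← Complex.normSq_eq_norm_sq, Complex.normSq_apply]
  have e2 : ‖α‖ ^ 2 = α.re * α.re + α.im * α.im := by
    rw [← Complex.normSq_eq_norm_sq, Complex.normSq_apply]
  have e3 : ‖η - α‖ ^ 2 = (η.re - α.re) * (η.re - α.re) + (η.im - α.im) * (η.im - α.im) := by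
    rw [← Complex.normSq_eq_norm_sq, Complex.normSq_apply, Complex.sub_re, Complex.sub_im]
  rw [hη] at e1
  rw [h1] at e2
  rw [h2] at e3
  have e4 : ‖α - t * η‖ ^ 2 = 0 := by
    rw [← Complex.normSq_eq_norm_sq, Complex.normSq_apply]
    simp only [Complex.sub_re, Complex.sub_im, Complex.mul_re, Complex.mul_im, Complex.ofReal_re,
      Complex.ofReal_im, zero_mul, sub_zero, add_zero]
    linear_combination (t - t ^ 2) * e1 + (t - 1) * e2 - t * e3
  exact sub_eq_zero.1 (norm_eq_zero.1 (pow_eq_zero_iff two_ne_zero |>.1 e4))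

/-- The elements `S_y r` with `0 ≤ r ≤ |y|` are determined by moduli. -/
theorem eq_of_modulus_eq {y v w : Complexification X} {r : X} (hr : r ≤ modulus y)
    (hv : modulus v = r) (hv' : modulus (y - v) = modulus y - r)
    (hw : modulus w = r) (hw' : modulus (y - w) = modulus y - r) : v = w := by
  have hu := modulus_nonneg y
  have hr0 : 0 ≤ r := hv ▸ modulus_nonneg v
  have hrI : r ∈ principalIdeal (modulus y) := mem_principalIdeal_of_nonneg_of_le hr0 hr
  have hyr := sub_mem (self_mem_principalIdeal hu) hrI
  have key : ∀ v : Complexification X, modulus v = r → modulus (y - v) = modulus y - r →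
      ∀ φ, IsCharacter (modulus y) φ → extendFunctional φ v = φ r * extendFunctional φ y := by
    intro v h1 h2 φ hφ
    refine Complex.eq_smul_of_norm_eq (norm_extendFunctional_unit hφ) ?_ ?_
    · rw [← modulus_map_character hφ hu (h1 ▸ hrI), h1]
    · rw [← map_sub, ← modulus_map_character hφ hu (h2 ▸ hyr), h2, map_sub, hφ.map_unit]
  refine eq_of_forall_extendFunctional hu (hv ▸ hrI) (hw ▸ hrI) fun φ hφ => ?_
  rw [key v hv hv' φ hφ, key w hw hw' φ hφ]

/-- Characterises `b(x,y)` by two equations between moduli that do not mention the operator `S_y`;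
maps preserving moduli transport both. -/
theorem eq_lacey {x y v : Complexification X} (h1 : modulus v = modulus x ⊓ modulus y)
    (h2 : modulus (y - v) = modulus y - modulus x ⊓ modulus y) : v = lacey x y :=
  eq_of_modulus_eq inf_le_right h1 h2 (modulus_lacey x y) (modulus_sub_lacey x y)

/-- Sign changes commute with `b`. -/
theorem IsSignChange.map_lacey {U : Complexification X →ₗ[ℂ] Complexification X}
    (hU : IsSignChange U) (x y : Complexification X) : U (lacey x y) = lacey (U x) (U y) := by
  apply eq_lacey
  · rw [hU, hU, hU, modulus_lacey]
  · rw [← map_sub, hU, hU, hU, modulus_sub_lacey]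

theorem IsSignChange.injective {U : Complexification X →ₗ[ℂ] Complexification X}
    (hU : IsSignChange U) : Function.Injective U := by
  refine (injective_iff_map_eq_zero U).2 fun z hz => ?_
  rw [← norm_eq_zero, ← norm_eq_of_modulus_eq (hU z), hz, norm_zero]

theorem IsSignChange.isometry {U : Complexification X →ₗ[ℂ] Complexification X}
    (hU : IsSignChange U) : Isometry U :=
  AddMonoidHomClass.isometry_of_norm U fun z => norm_eq_of_modulus_eq (hU z)

/-- The complexification of a closed sublattice is closed under `b`. -/
theorem lacey_mem {Y : Submodule ℝ X} (hYc : IsClosed (Y : Set X)) (hY : IsVectorSublattice Y)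
    {x y : Complexification X} (hx : modulus x ∈ Y) (hy : modulus y ∈ Y) (hre : y.re ∈ Y)
    (him : y.im ∈ Y) : (lacey x y).re ∈ Y ∧ (lacey x y).im ∈ Y := by
  have hu := modulus_nonneg y
  have huI := self_mem_principalIdeal hu
  set r := modulus x ⊓ modulus y with hr
  have hr0 : 0 ≤ r := le_inf (modulus_nonneg x) hu
  have hrI : r ∈ principalIdeal (modulus y) := mem_principalIdeal_of_nonneg_of_le hr0 inf_le_right
  have hrI' : modulus (ofReal r) ∈ principalIdeal (modulus y) := by
    rwa [modulus_ofReal, abs_of_nonneg hr0]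
  -- The candidate for `b(x,y)` is the product `y · r` with `|y|` as unit. Unlike the value of
  -- `S_y`, it is known to have both parts in `Y`.
  obtain ⟨v, hv, hφv, hYv⟩ := exists_complex_mul hu (z := y) (w := ofReal r) huI hrI'
  have hyr := sub_mem huI hrI
  have hyv : modulus (y - v) ∈ principalIdeal (modulus y) := by
    rw [modulus_mem_principalIdeal] at hv huI ⊢
    exact ⟨sub_mem huI.1 hv.1, sub_mem huI.2 hv.2⟩
  have hlv : v = lacey x y := by
    apply eq_lacey
    · refine eq_of_forall_isCharacter hu hv hrI fun φ hφ => ?_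
      rw [modulus_map_character hφ hu hv, hφv φ hφ, norm_mul, norm_extendFunctional_unit hφ,
        one_mul, ← modulus_map_character hφ hu hrI', modulus_ofReal, abs_of_nonneg hr0]
    · refine eq_of_forall_isCharacter hu hyv hyr fun φ hφ => ?_
      have h1 := hφ.mono hrI huI inf_le_right
      rw [hφ.map_unit] at h1
      have h2 : extendFunctional φ y - extendFunctional φ y * (φ r : ℂ) =
          extendFunctional φ y * ((1 - φ r : ℝ) : ℂ) := by push_cast; ring
      rw [modulus_map_character hφ hu hyv, map_sub, hφv φ hφ, extendFunctional_ofReal, h2, norm_mul,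
        norm_extendFunctional_unit hφ, one_mul, Complex.norm_real,
        Real.norm_of_nonneg (by linarith), map_sub, hφ.map_unit]
  rw [← hlv]
  exact hYv Y hYc hY hy hre him (hY _ hx _ hy).2 (zero_mem _)

/-- A closed sublattice contains the moduli of the elements of its complexification. -/
theorem modulus_mem (hX : IsOrderContinuous X) {Y : Submodule ℝ X} (hYc : IsClosed (Y : Set X))
    (hY : IsVectorSublattice Y) {z : Complexification X} (hre : z.re ∈ Y) (him : z.im ∈ Y) :
    modulus z ∈ Y := by
  -- The elements of `Y` below `|z|` form an upward directed set containing every rotation of `z`.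
  -- Its limit lies in `Y` and is the supremum of the rotations.
  let D := {d : X // d ∈ Y ∧ d ≤ modulus z}
  have : IsDirectedOrder D := ⟨fun a b => ⟨⟨a.1 ⊔ b.1, (hY _ a.2.1 _ b.2.1).1,
    sup_le a.2.2 b.2.2⟩, (le_sup_left : a.1 ≤ a.1 ⊔ b.1), (le_sup_right : b.1 ≤ a.1 ⊔ b.1)⟩⟩
  have : Nonempty D := ⟨⟨0, zero_mem _, modulus_nonneg z⟩⟩
  obtain ⟨l, hl, ht⟩ := exists_isLUB_tendsto hX (f := fun d : D => (d : X)) (fun _ _ h => h)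
    (fun d => d.2.2)
  have hlY : l ∈ Y := hYc.mem_of_tendsto ht (Eventually.of_forall fun d => d.2.1)
  have : modulus z = l := le_antisymm
    (modulus_le fun θ => hl.1 ⟨⟨rot z θ, add_mem (Y.smul_mem _ hre) (Y.smul_mem _ him),
      rot_le_modulus z θ⟩, rfl⟩)
    (hl.2 (by rintro _ ⟨d, rfl⟩; exact d.2.2))
  rwa [this]

end Sign

end Complexification

/-! ### Band projections -/

section Bands

variable {X : Type*} [NormedAddCommGroup X] [NormedSpace ℝ X] [Lattice X] [IsOrderedAddMonoid X]
  [IsOrderedModule ℝ X] [HasSolidNorm X]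

theorem abs_add_and_sub_of_disjoint {p q : X} (h : |p| ⊓ |q| = 0) :
    |p + q| = |p| + |q| ∧ |p - q| = |p| + |q| := by
  set u := |p| + |q|
  have hu : 0 ≤ u := add_nonneg (abs_nonneg _) (abs_nonneg _)
  have hp : p ∈ principalIdeal u :=
    mem_principalIdeal_of_abs_le_self (le_add_of_nonneg_right (abs_nonneg q))
  have hq : q ∈ principalIdeal u :=
    mem_principalIdeal_of_abs_le_self (le_add_of_nonneg_left (abs_nonneg p))
  have hap := abs_mem_principalIdeal hp
  have haq := abs_mem_principalIdeal hq
  have key : ∀ φ, IsCharacter u φ → φ p = 0 ∨ φ q = 0 := fun φ hφ => by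
    have h1 := hφ.map_inf hap haq
    rw [h, map_zero, hφ.map_abs _ hp, hφ.map_abs _ hq] at h1
    rcases min_choice |φ p| |φ q| with h2 | h2
    · exact Or.inl (abs_eq_zero.1 (h2.symm.trans h1.symm))
    · exact Or.inr (abs_eq_zero.1 (h2.symm.trans h1.symm))
  constructor
  · refine eq_of_forall_isCharacter hu (abs_mem_principalIdeal (add_mem hp hq)) (add_mem hap haq)
      fun φ hφ => ?_
    rw [hφ.map_abs _ (add_mem hp hq), map_add, map_add, hφ.map_abs _ hp, hφ.map_abs _ hq]
    rcases key φ hφ with h | h <;> simp [h]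
  · refine eq_of_forall_isCharacter hu (abs_mem_principalIdeal (sub_mem hp hq)) (add_mem hap haq)
      fun φ hφ => ?_
    rw [hφ.map_abs _ (sub_mem hp hq), map_add, map_sub, hφ.map_abs _ hp, hφ.map_abs _ hq]
    rcases key φ hφ with h | h <;> simp [h]

theorem isClosed_bandCompl (A : Set X) : IsClosed (bandCompl A : Set X) := by
  have : (bandCompl A : Set X) = ⋂ a ∈ A, {x : X | |x| ⊓ |a| = 0} := by
    ext x
    simp only [SetLike.mem_coe, mem_bandCompl, Set.mem_iInter, Set.mem_ofPred_eq]
  rw [this]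
  refine isClosed_biInter fun a _ => isClosed_eq ?_ continuous_const
  exact (continuous_id.sup continuous_neg).inf continuous_const

theorem eq_zero_of_mem_bandCompl {A : Set X} {x : X} (hx : x ∈ bandCompl A)
    (hx' : x ∈ bandCompl (bandCompl A : Set X)) : x = 0 := by
  exact eq_zero_of_abs_eq_zero (by simpa using hx' x hx)

theorem eq_of_mem_bandCompl {A : Set X} {x p q : X} (hp : p ∈ bandCompl (bandCompl A : Set X))
    (hp' : x - p ∈ bandCompl A) (hq : q ∈ bandCompl (bandCompl A : Set X))
    (hq' : x - q ∈ bandCompl A) : p = q := by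
  refine sub_eq_zero.1 (eq_zero_of_mem_bandCompl (A := A) ?_ (sub_mem hp hq))
  have : p - q = (x - q) - (x - p) := by abel
  rw [this]
  exact sub_mem hq' hp'

variable [CompleteSpace X]

/-- For `x ≥ 0` the truncations of `x` by positive elements of `A^⊥` converge to the component of
`x` in `A^⊥`, and what remains is disjoint from `A^⊥`. Uniqueness of the decomposition gives
linearity. -/
theorem exists_bandProjection (hX : IsOrderContinuous X) (A : Set X) :
    ∃ P : X →ₗ[ℝ] X, ∀ x, P x ∈ bandCompl (bandCompl A : Set X) ∧ x - P x ∈ bandCompl A := by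
  have hpos : ∀ x : X, 0 ≤ x → ∃ p, p ∈ bandCompl (bandCompl A : Set X) ∧ x - p ∈ bandCompl A := by
    intro x hx
    obtain ⟨F, l, hF, hl0, hlx, ht, hd⟩ := exists_tendsto_inf hX
      (C := {c | c ∈ bandCompl A ∧ 0 ≤ c}) ⟨zero_mem _, le_rfl⟩ (fun c hc => hc.2)
      (fun c hc d hd => ⟨add_mem hc.1 hd.1, add_nonneg hc.2 hd.2⟩) hx
    have hl : l ∈ bandCompl A := (isClosed_bandCompl A).mem_of_tendsto ht
      (Eventually.of_forall fun c => mem_bandCompl_of_abs_le c.2.1 (by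
        rw [abs_of_nonneg (le_inf hx c.2.2), abs_of_nonneg c.2.2]; exact inf_le_right))
    refine ⟨x - l, fun b hb => ?_, by rwa [sub_sub_cancel]⟩
    rw [abs_of_nonneg (sub_nonneg.2 hlx)]
    exact hd _ ⟨mem_bandCompl_of_abs_le hb (abs_abs b).le, abs_nonneg b⟩
  have h : ∀ x : X, ∃ p, p ∈ bandCompl (bandCompl A : Set X) ∧ x - p ∈ bandCompl A := by
    intro x
    obtain ⟨p, hp, hp'⟩ := hpos x⁺ (posPart_nonneg x)
    obtain ⟨q, hq, hq'⟩ := hpos x⁻ (negPart_nonneg x)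
    refine ⟨p - q, sub_mem hp hq, ?_⟩
    have : x - (p - q) = (x⁺ - p) - (x⁻ - q) := by
      nth_rewrite 1 [← posPart_sub_negPart x]
      abel
    rw [this]
    exact sub_mem hp' hq'
  choose P hP using h
  refine ⟨{ toFun := P, map_add' := fun x y => ?_, map_smul' := fun t x => ?_ }, hP⟩
  · refine eq_of_mem_bandCompl (hP _).1 (hP _).2 (add_mem (hP x).1 (hP y).1) ?_
    rw [add_sub_add_comm]
    exact add_mem (hP x).2 (hP y).2
  · refine eq_of_mem_bandCompl (hP _).1 (hP _).2 (Submodule.smul_mem _ _ (hP x).1) ?_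
    rw [RingHom.id_apply, ← smul_sub]
    exact Submodule.smul_mem _ _ (hP x).2

/-- The projection onto the band generated by `A`. -/
noncomputable def bandProjection (hX : IsOrderContinuous X) (A : Set X) : X →ₗ[ℝ] X :=
  (exists_bandProjection hX A).choose

variable (hX : IsOrderContinuous X)

theorem bandProjection_mem (A : Set X) (x : X) :
    bandProjection hX A x ∈ bandCompl (bandCompl A : Set X) :=
  ((exists_bandProjection hX A).choose_spec x).1

theorem sub_bandProjection_mem (A : Set X) (x : X) : x - bandProjection hX A x ∈ bandCompl A :=
  ((exists_bandProjection hX A).choose_spec x).2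

theorem bandProjection_eq {A : Set X} {x p : X} (hp : p ∈ bandCompl (bandCompl A : Set X))
    (hp' : x - p ∈ bandCompl A) : bandProjection hX A x = p :=
  eq_of_mem_bandCompl (bandProjection_mem hX A x) (sub_bandProjection_mem hX A x) hp hp'

theorem abs_bandProjection_add (A : Set X) (x : X) :
    |bandProjection hX A x| + |x - bandProjection hX A x| = |x| := by
  rw [← (abs_add_and_sub_of_disjoint
    (bandProjection_mem hX A x _ (sub_bandProjection_mem hX A x))).1, add_sub_cancel]

theorem bandProjection_abs (A : Set X) (x : X) :
    bandProjection hX A |x| = |bandProjection hX A x| := by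
  refine bandProjection_eq hX
    (mem_bandCompl_of_abs_le (bandProjection_mem hX A x) (abs_abs _).le) ?_
  rw [← abs_bandProjection_add hX A x, add_sub_cancel_left]
  exact mem_bandCompl_of_abs_le (sub_bandProjection_mem hX A x) (abs_abs _).le

theorem bandProjection_nonneg (A : Set X) {x : X} (hx : 0 ≤ x) : 0 ≤ bandProjection hX A x := by
  rw [← abs_of_nonneg hx, bandProjection_abs]
  exact abs_nonneg _

theorem bandProjection_le (A : Set X) {x : X} (hx : 0 ≤ x) : bandProjection hX A x ≤ x := by
  have h := abs_bandProjection_add hX A x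
  rw [abs_of_nonneg hx] at h
  calc bandProjection hX A x ≤ |bandProjection hX A x| := le_abs_self _
    _ ≤ |bandProjection hX A x| + |x - bandProjection hX A x| :=
        le_add_of_nonneg_right (abs_nonneg _)
    _ = x := h

end Bands

/-- Zorn's lemma for disjoint families, for elements measured by a modulus `m`. -/
theorem exists_maximal_disjoint {V X : Type*} [Lattice X] [Zero X] (m : V → X) (E : Set V) :
    ∃ S ⊆ E, (∀ e ∈ S, ∀ f ∈ S, e ≠ f → m e ⊓ m f = 0) ∧
      ∀ x ∈ E, (∀ e ∈ S, m x ⊓ m e = 0) → m x = 0 := by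
  obtain ⟨S, hS⟩ := zorn_subset
    {S : Set V | S ⊆ E ∧ ∀ e ∈ S, ∀ f ∈ S, e ≠ f → m e ⊓ m f = 0} (by
      intro c hc hchain
      refine ⟨⋃₀ c, ⟨Set.sUnion_subset fun s hs => (hc hs).1, ?_⟩, fun s hs =>
        Set.subset_sUnion_of_mem hs⟩
      rintro e ⟨s, hs, he⟩ f ⟨t, ht, hf⟩ hne
      rcases hchain.total hs ht with h | h
      · exact (hc ht).2 e (h he) f hf hne
      · exact (hc hs).2 e he f (h hf) hne)
  refine ⟨S, hS.prop.1, hS.prop.2, fun x hx hd => ?_⟩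
  have h : insert x S ⊆ S := by
    refine hS.le_of_ge ⟨Set.insert_subset hx hS.prop.1, ?_⟩ (Set.subset_insert x S)
    rintro e (rfl | he) f (rfl | hf) hne
    · exact absurd rfl hne
    · exact hd f hf
    · rw [inf_comm]; exact hd e he
    · exact hS.prop.2 e he f hf hne
  simpa using hd x (h (Set.mem_insert x S))

/-! ### The real equivalence -/

section RealCase

variable {X : Type*} [NormedAddCommGroup X] [NormedSpace ℝ X] [Lattice X] [IsOrderedAddMonoid X]
  [IsOrderedModule ℝ X] [HasSolidNorm X]

/-- At each character one of `y⁺`, `y⁻` vanishes, and both identities become statements about real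
numbers. -/
theorem abs_laceyReal_and_abs_sub (x y : X) :
    |laceyReal x y| = |x| ⊓ |y| ∧ |y - laceyReal x y| = |y| - |x| ⊓ |y| := by
  set u := |x| + |y|
  have hu : 0 ≤ u := add_nonneg (abs_nonneg _) (abs_nonneg _)
  have hx : x ∈ principalIdeal u :=
    mem_principalIdeal_of_abs_le_self (le_add_of_nonneg_right (abs_nonneg y))
  have hy : y ∈ principalIdeal u :=
    mem_principalIdeal_of_abs_le_self (le_add_of_nonneg_left (abs_nonneg x))
  have hax := abs_mem_principalIdeal hx
  have hay := abs_mem_principalIdeal hy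
  have hxy := inf_mem_principalIdeal hax hay
  have hyp : y⁺ ∈ principalIdeal u := sup_mem_principalIdeal hy (zero_mem _)
  have hyn : y⁻ ∈ principalIdeal u := sup_mem_principalIdeal (neg_mem hy) (zero_mem _)
  have hb : laceyReal x y ∈ principalIdeal u :=
    sub_mem (inf_mem_principalIdeal hax hyp) (inf_mem_principalIdeal hax hyn)
  have hφb : ∀ φ, IsCharacter u φ → φ (laceyReal x y) =
      |φ x| ⊓ (φ y ⊔ 0) - |φ x| ⊓ (-φ y ⊔ 0) := fun φ hφ => by
    have h1 : φ y⁺ = φ y ⊔ 0 := by rw [posPart_def, hφ.map_sup hy (zero_mem _), map_zero]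
    have h2 : φ y⁻ = -φ y ⊔ 0 := by
      rw [negPart_def, hφ.map_sup (neg_mem hy) (zero_mem _), map_zero, map_neg]
    rw [laceyReal, map_sub, hφ.map_inf hax hyp, hφ.map_inf hax hyn, hφ.map_abs _ hx, h1, h2]
  constructor
  · refine eq_of_forall_isCharacter hu (abs_mem_principalIdeal hb) hxy fun φ hφ => ?_
    rw [hφ.map_abs _ hb, hφb φ hφ, hφ.map_inf hax hay, hφ.map_abs _ hx, hφ.map_abs _ hy]
    rcases le_total 0 (φ y) with h | h
    · rw [sup_eq_left.2 h, sup_eq_right.2 (neg_nonpos.2 h), inf_eq_right.2 (abs_nonneg (φ x)),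
        sub_zero, abs_of_nonneg (le_inf (abs_nonneg _) h), abs_of_nonneg h]
    · rw [sup_eq_right.2 h, sup_eq_left.2 (neg_nonneg.2 h), inf_eq_right.2 (abs_nonneg (φ x)),
        zero_sub, abs_neg, abs_of_nonneg (le_inf (abs_nonneg _) (neg_nonneg.2 h)), abs_of_nonpos h]
  · refine eq_of_forall_isCharacter hu (abs_mem_principalIdeal (sub_mem hy hb)) (sub_mem hay hxy)
      fun φ hφ => ?_
    rw [hφ.map_abs _ (sub_mem hy hb), map_sub, map_sub, hφb φ hφ, hφ.map_inf hax hay,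
      hφ.map_abs _ hx, hφ.map_abs _ hy]
    rcases le_total 0 (φ y) with h | h
    · rw [sup_eq_left.2 h, sup_eq_right.2 (neg_nonpos.2 h), inf_eq_right.2 (abs_nonneg (φ x)),
        sub_zero, abs_of_nonneg h, abs_of_nonneg (sub_nonneg.2 inf_le_right)]
    · rw [sup_eq_right.2 h, sup_eq_left.2 (neg_nonneg.2 h), inf_eq_right.2 (abs_nonneg (φ x)),
        zero_sub, abs_of_nonpos h, sub_neg_eq_add, abs_of_nonpos, neg_add, sub_eq_add_neg]
      have : |φ x| ⊓ -φ y ≤ -φ y := inf_le_right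
      linarith

theorem abs_eq_of_isBandProjection {P : X →ₗ[ℝ] X} (hP : IsBandProjection P) (x : X) :
    |((2 : ℝ) • P - LinearMap.id : X →ₗ[ℝ] X) x| = |x| := by
  obtain ⟨B, -, hB⟩ := hP
  have hd : |x - P x| ⊓ |P x| = 0 := (hB x).2 _ (hB x).1
  have h := abs_add_and_sub_of_disjoint hd
  have e1 : x - P x + P x = x := by abel
  have e2 : ((2 : ℝ) • P - LinearMap.id : X →ₗ[ℝ] X) x = -(x - P x - P x) := by
    simp only [LinearMap.sub_apply, LinearMap.smul_apply, LinearMap.id_apply]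
    module
  rw [e2, abs_neg, h.2, ← h.1, e1]

variable [CompleteSpace X]

/-- The real case is read off from the complex uniqueness statement, since `ofReal` turns moduli
into absolute values. -/
theorem eq_laceyReal {x y v : X} (h1 : |v| = |x| ⊓ |y|) (h2 : |y - v| = |y| - |x| ⊓ |y|) :
    v = laceyReal x y := by
  have h := abs_laceyReal_and_abs_sub x y
  have := Complexification.eq_of_modulus_eq (y := Complexification.ofReal y)
    (v := Complexification.ofReal v) (w := Complexification.ofReal (laceyReal x y))
    (r := |x| ⊓ |y|) (by rw [Complexification.modulus_ofReal]; exact inf_le_right)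
    (by rw [Complexification.modulus_ofReal, h1])
    (by rw [← Complexification.ofReal_sub, Complexification.modulus_ofReal,
      Complexification.modulus_ofReal, h2])
    (by rw [Complexification.modulus_ofReal, h.1])
    (by rw [← Complexification.ofReal_sub, Complexification.modulus_ofReal,
      Complexification.modulus_ofReal, h.2])
  exact congrArg Complexification.re this

theorem map_laceyReal {U : X →ₗ[ℝ] X} (hU : ∀ x, |U x| = |x|) (x y : X) :
    U (laceyReal x y) = laceyReal (U x) (U y) := by
  have h := abs_laceyReal_and_abs_sub x y
  apply eq_laceyReal
  · rw [hU, hU, hU, h.1]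
  · rw [← map_sub, hU, hU, hU, h.2]

theorem laceyReal_mem_of_isClosedSublatticeUpToSignChange {E : Submodule ℝ X}
    (hE : IsClosedSublatticeUpToSignChange E) {x y : X} (hx : x ∈ E) (hy : y ∈ E) :
    laceyReal x y ∈ E := by
  obtain ⟨U, ⟨-, P, hP, rfl⟩, -, hsub⟩ := hE
  set U := (2 : ℝ) • P - LinearMap.id with hUdef
  have hU : ∀ x, |U x| = |x| := abs_eq_of_isBandProjection hP
  have hUx : U x ∈ E.map U := Submodule.mem_map_of_mem hx
  have hUy : U y ∈ E.map U := Submodule.mem_map_of_mem hy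
  have hb : laceyReal (U x) (U y) ∈ E.map U := by
    have hax : |U x| ∈ E.map U := hsub.abs_mem hUx
    exact sub_mem (hsub _ hax _ (hsub _ hUy _ (zero_mem _)).1).2
      (hsub _ hax _ (hsub _ (neg_mem hUy) _ (zero_mem _)).1).2
  rw [← map_laceyReal hU] at hb
  obtain ⟨e, he, heq⟩ := hb
  rwa [← injective_of_abs_eq hU heq]

theorem isClosedSublatticeUpToSignChange_of_laceyReal_mem (hX : IsOrderContinuous X)
    {E : Submodule ℝ X} (hEc : IsClosed (E : Set X)) (hE : ∀ x ∈ E, ∀ y ∈ E, laceyReal x y ∈ E) :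
    IsClosedSublatticeUpToSignChange E := by
  obtain ⟨S, hSE, hdisj, hmax⟩ := exists_maximal_disjoint (fun x : X => |x|) (E : Set X)
  -- `U` is to change the sign exactly on the band generated by the negative parts of the members of
  -- `S`. Disjointness of `S` keeps each `e⁺` disjoint from all these negative parts, so `U e = e⁺ +
  -- e⁻ = |e|`.
  let A : Set X := (fun e : X => e⁻) '' S
  let P : X →ₗ[ℝ] X := LinearMap.id - bandProjection hX A
  have hP : IsBandProjection P := by
    refine ⟨disjointCompl A, ⟨A, rfl⟩, fun x => ⟨sub_bandProjection_mem hX A x, ?_⟩⟩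
    have : x - P x = bandProjection hX A x := by simp [P]
    rw [this]
    exact bandProjection_mem hX A x
  set U : X →ₗ[ℝ] X := (2 : ℝ) • P - LinearMap.id with hUdef
  have hU : ∀ x, |U x| = |x| := abs_eq_of_isBandProjection hP
  have hiso : Isometry U := AddMonoidHomClass.isometry_of_norm U fun x => by
    rw [← norm_abs_eq_norm, hU, norm_abs_eq_norm]
  have hFc : IsClosed (E.map U : Set X) := by
    rw [Submodule.map_coe]
    exact hiso.isClosedEmbedding.isClosedMap _ hEc
  have hUS : ∀ e ∈ S, U e = |e| := by
    intro e he
    have h1 : bandProjection hX A e = -e⁻ := by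
      refine bandProjection_eq hX (neg_mem (subset_bandCompl_bandCompl A ⟨e, he, rfl⟩)) ?_
      rintro _ ⟨f, hf, rfl⟩
      have e1 : e - -e⁻ = e⁺ := by
        nth_rewrite 1 [← posPart_sub_negPart e]
        abel
      rw [e1, abs_of_nonneg (posPart_nonneg e)]
      simp only [abs_of_nonneg (negPart_nonneg f)]
      by_cases hef : e = f
      · rw [hef]; exact posPart_inf_negPart_eq_zero f
      · refine le_antisymm ?_ (le_inf (posPart_nonneg _) (negPart_nonneg _))
        rw [← hdisj e he f hf hef]
        refine inf_le_inf ?_ ?_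
        · rw [← posPart_add_negPart]; exact le_add_of_nonneg_right (negPart_nonneg _)
        · rw [← posPart_add_negPart]; exact le_add_of_nonneg_left (posPart_nonneg _)
    simp only [hUdef, P, LinearMap.sub_apply, LinearMap.smul_apply, LinearMap.id_apply, h1]
    rw [← posPart_add_negPart e]
    nth_rewrite 1 3 [← posPart_sub_negPart e]
    module
  have habs : ∀ x ∈ E, |x| ∈ E.map U := by
    intro x hx
    obtain ⟨F, l, hF, hl0, hlx, ht, hd⟩ := exists_tendsto_inf hX
      (C := {c | ∃ g ∈ E, U g = |g| ∧ |g| = c}) ⟨0, zero_mem _, by simp, by simp⟩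
      (by rintro _ ⟨g, -, -, rfl⟩; exact abs_nonneg g)
      (by
        rintro _ ⟨g, hg, hUg, rfl⟩ _ ⟨h, hh, hUh, rfl⟩
        -- `U (g + h) = |g| + |h|` is positive, so it equals its own modulus, which is `|g + h|`.
        have e : |g + h| = |g| + |h| := by
          rw [← hU, map_add, hUg, hUh, abs_of_nonneg (add_nonneg (abs_nonneg _) (abs_nonneg _))]
        exact ⟨g + h, add_mem hg hh, by rw [map_add, hUg, hUh, e], e⟩) (abs_nonneg x)
    have hposle : x⁺ ≤ |x| := by
      rw [← posPart_add_negPart]; exact le_add_of_nonneg_right (negPart_nonneg _)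
    have hnegle : x⁻ ≤ |x| := by
      rw [← posPart_add_negPart]; exact le_add_of_nonneg_left (posPart_nonneg _)
    choose g hgE hUg hgc using fun c : {c | ∃ g ∈ E, U g = |g| ∧ |g| = c} => c.2
    -- Written in this way, `b(g,x)` depends on `c` only through the truncation `|x| ∧ c`, so it
    -- converges along with it.
    have hb : ∀ c, laceyReal (g c) x = |x| ⊓ c ⊓ x⁺ - |x| ⊓ c ⊓ x⁻ := by
      intro c
      rw [laceyReal, hgc, inf_comm |x| _, inf_assoc, inf_assoc, inf_eq_right.2 hposle,
        inf_eq_right.2 hnegle]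
    have htv : Tendsto (fun c => laceyReal (g c) x) F (𝓝 (l ⊓ x⁺ - l ⊓ x⁻)) := by
      simp only [hb]
      exact (ht.inf_nhds tendsto_const_nhds).sub (ht.inf_nhds tendsto_const_nhds)
    set v := l ⊓ x⁺ - l ⊓ x⁻
    have hvE : v ∈ E := hEc.mem_of_tendsto htv
      (Eventually.of_forall fun c => hE _ (hgE c) _ hx)
    have hxv : |x - v| = |x| - l := by
      have h1 : Tendsto (fun c => |x - laceyReal (g c) x|) F (𝓝 |x - v|) :=
        (tendsto_const_nhds.sub htv).sup_nhds (tendsto_const_nhds.sub htv).neg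
      refine tendsto_nhds_unique h1 ?_
      simp only [(abs_laceyReal_and_abs_sub _ _).2, hgc, inf_comm _ |x|]
      exact tendsto_const_nhds.sub ht
    have h0 : |x - v| = 0 := hmax _ (sub_mem hx hvE) fun e he => by
      have := hd |e| ⟨e, hSE he, hUS e he, rfl⟩
      simpa only [hxv] using this
    have hl : |x| = l := by rw [← sub_eq_zero, ← hxv, h0]
    rw [hl]
    refine hFc.mem_of_tendsto ht (Eventually.of_forall fun c => ?_)
    -- The order of arguments is now reversed: `U b(x,g) = b(U x, c) = |x| ∧ c`, because `c ≥ 0`.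
    refine ⟨laceyReal x (g c), hE _ hx _ (hgE c), ?_⟩
    have hc0 : 0 ≤ (c : X) := hgc c ▸ abs_nonneg _
    rw [map_laceyReal hU, laceyReal, hU, hUg, hgc, posPart_eq_self.2 hc0, negPart_eq_zero.2 hc0,
      inf_eq_right.2 (abs_nonneg x), sub_zero]
  refine ⟨U, ⟨hiso, P, hP, rfl⟩, hFc, ?_⟩
  have habs' : ∀ x ∈ E.map U, |x| ∈ E.map U := by
    rintro _ ⟨x, hx, rfl⟩
    rw [hU]
    exact habs x hx
  intro x hx y hy
  rw [sup_eq_smul, inf_eq_smul]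
  exact ⟨Submodule.smul_mem _ _ (add_mem (add_mem hx hy) (habs' _ (sub_mem hy hx))),
    Submodule.smul_mem _ _ (sub_mem (add_mem hx hy) (habs' _ (sub_mem hy hx)))⟩

end RealCase

/-! ### The complex equivalence -/

namespace Complexification

section ComplexCase

variable {X : Type*} [NormedAddCommGroup X] [NormedSpace ℝ X] [Lattice X] [IsOrderedAddMonoid X]
  [IsOrderedModule ℝ X] [HasSolidNorm X] [CompleteSpace X]

/-- The complexification of a band projection. -/
noncomputable def bandProjectionC (hX : IsOrderContinuous X) (A : Set X) :
    Complexification X →ₗ[ℂ] Complexification X where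
  toFun z := ⟨bandProjection hX A z.re, bandProjection hX A z.im⟩
  map_add' z w := by ext <;> simp
  map_smul' c z := by ext <;> simp

/-- Both `≤` hold because the projection and its complement are positive operators. The two upper
bounds add up to `|z|`, which the triangle inequality bounds by the sum of the two moduli, so both
are equalities. -/
theorem modulus_bandProjectionC_and_sub (hX : IsOrderContinuous X) (A : Set X)
    (z : Complexification X) :
    modulus (bandProjectionC hX A z) = bandProjection hX A (modulus z) ∧
      modulus (z - bandProjectionC hX A z) = modulus z - bandProjection hX A (modulus z) := by
  have h1 : modulus (bandProjectionC hX A z) ≤ bandProjection hX A (modulus z) := by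
    refine modulus_le fun θ => ?_
    have e : rot (bandProjectionC hX A z) θ = bandProjection hX A (rot z θ) := by
      simp [rot, bandProjectionC]
    rw [e, ← sub_nonneg, ← map_sub]
    exact bandProjection_nonneg hX A (sub_nonneg.2 (rot_le_modulus z θ))
  have h2 : modulus (z - bandProjectionC hX A z) ≤
      modulus z - bandProjection hX A (modulus z) := by
    refine modulus_le fun θ => ?_
    have e : rot (z - bandProjectionC hX A z) θ = rot z θ - bandProjection hX A (rot z θ) := by
      simp only [rot, bandProjectionC, LinearMap.coe_mk, AddHom.coe_mk, sub_re, sub_im, map_add,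
        map_smul]
      module
    have h := bandProjection_le hX A (sub_nonneg.2 (rot_le_modulus z θ))
    rw [map_sub] at h
    rw [e, ← sub_nonneg]
    refine (sub_nonneg.2 h).trans (le_of_eq ?_)
    abel
  have h3 := modulus_add_le (bandProjectionC hX A z) (z - bandProjectionC hX A z)
  rw [add_sub_cancel] at h3
  refine ⟨le_antisymm h1 ?_, le_antisymm h2 ?_⟩
  · have h := h3.trans (add_le_add_right h2 _)
    rw [← add_sub_assoc, le_sub_iff_add_le, add_comm] at h
    exact le_of_add_le_add_right h
  · rw [sub_le_iff_le_add']
    exact h3.trans (add_le_add_left h1 _)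

theorem continuous_bandProjectionC (hX : IsOrderContinuous X) (A : Set X) :
    Continuous (bandProjectionC hX A) := by
  refine AddMonoidHomClass.continuous_of_bound (bandProjectionC hX A) 1 fun z => ?_
  rw [one_mul, norm_def, norm_def, (modulus_bandProjectionC_and_sub hX A z).1]
  refine norm_le_norm_of_abs_le_abs ?_
  rw [abs_of_nonneg (bandProjection_nonneg hX A (modulus_nonneg z)), abs_modulus]
  exact bandProjection_le hX A (modulus_nonneg z)

theorem bandProjectionC_eq_self (hX : IsOrderContinuous X) {A : Set X} {z : Complexification X}
    (hz : modulus z ∈ bandCompl (bandCompl A : Set X)) : bandProjectionC hX A z = z := by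
  ext
  · exact bandProjection_eq hX
      (mem_bandCompl_of_abs_le hz ((abs_re_le_modulus z).trans (le_abs_self _))) (by simp)
  · exact bandProjection_eq hX
      (mem_bandCompl_of_abs_le hz ((abs_im_le_modulus z).trans (le_abs_self _))) (by simp)

theorem bandProjection_eq_zero (hX : IsOrderContinuous X) {A : Set X} {x : X}
    (hx : x ∈ bandCompl A) : bandProjection hX A x = 0 :=
  bandProjection_eq hX (zero_mem _) (by rwa [sub_zero])

theorem bandProjectionC_eq_zero (hX : IsOrderContinuous X) {A : Set X} {z : Complexification X}
    (hz : modulus z ∈ bandCompl A) : bandProjectionC hX A z = 0 := by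
  ext
  · exact bandProjection_eq_zero hX
      (mem_bandCompl_of_abs_le hz ((abs_re_le_modulus z).trans (le_abs_self _)))
  · exact bandProjection_eq_zero hX
      (mem_bandCompl_of_abs_le hz ((abs_im_le_modulus z).trans (le_abs_self _)))

/-- The closed ideal generated by `y` contains the band generated by `y`. -/
theorem mem_closedIdeal_of_modulus_mem (hX : IsOrderContinuous X) {y z : Complexification X}
    (hz : modulus z ∈ bandCompl (bandCompl {modulus y} : Set X)) : z ∈ closedIdeal y := by
  have hu := modulus_nonneg y
  have hpos : ∀ r : X, 0 ≤ r → r ≤ modulus z → ofReal r ∈ closedIdeal y := by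
    intro r hr hrz
    have hrB : r ∈ bandCompl (bandCompl {modulus y} : Set X) := mem_bandCompl_of_abs_le hz (by
      rwa [abs_of_nonneg hr, abs_modulus])
    obtain ⟨F, l, hF, hl0, hlr, ht, hd⟩ := exists_tendsto_inf hX
      (C := {c | ∃ n : ℕ, c = n • modulus y}) ⟨0, by simp⟩
      (by rintro _ ⟨n, rfl⟩; exact nsmul_nonneg hu n)
      (by rintro _ ⟨n, rfl⟩ _ ⟨m, rfl⟩; exact ⟨n + m, (add_nsmul _ _ _).symm⟩) hr
    have h1 : r - l ∈ bandCompl {modulus y} := by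
      rintro _ rfl
      rw [abs_of_nonneg (sub_nonneg.2 hlr), abs_modulus]
      exact hd _ ⟨1, (one_nsmul _).symm⟩
    have h2 : r - l ∈ bandCompl (bandCompl {modulus y} : Set X) := mem_bandCompl_of_abs_le hrB (by
      rw [abs_of_nonneg (sub_nonneg.2 hlr), abs_of_nonneg hr]
      exact sub_le_self _ hl0)
    rw [sub_eq_zero.1 (eq_zero_of_mem_bandCompl h1 h2)]
    refine (ideal₀ y).isClosed_topologicalClosure.mem_of_tendsto
      ((continuous_ofReal.tendsto l).comp ht) (Eventually.of_forall ?_)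
    rintro ⟨_, n, rfl⟩
    refine (ideal₀ y).le_topologicalClosure ⟨n, ?_⟩
    rw [Function.comp_apply, modulus_ofReal, abs_of_nonneg (le_inf hr (nsmul_nonneg hu n))]
    exact inf_le_right
  have habs : ∀ a : X, |a| ≤ modulus z → ofReal a ∈ closedIdeal y := by
    intro a ha
    rw [← posPart_sub_negPart a, ofReal_sub]
    rw [← posPart_add_negPart] at ha
    exact sub_mem
      (hpos _ (posPart_nonneg a) ((le_add_of_nonneg_right (negPart_nonneg a)).trans ha))
      (hpos _ (negPart_nonneg a) ((le_add_of_nonneg_left (posPart_nonneg a)).trans ha))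
  rw [eq_ofReal_add z]
  exact add_mem (habs _ (abs_re_le_modulus z))
    (Submodule.smul_mem _ _ (habs _ (abs_im_le_modulus z)))

/-- The complex conjugate `a - ib` of `a + ib`. -/
def conj (z : Complexification X) : Complexification X := ⟨z.re, -z.im⟩

theorem modulus_conj (z : Complexification X) : modulus (conj z) = modulus z := by
  have h : ∀ z : Complexification X, modulus (conj z) ≤ modulus z := fun z =>
    modulus_le fun θ => by
      have e : rot (conj z) θ = rot z (-θ) := by simp [rot, conj]
      rw [e]
      exact rot_le_modulus z (-θ)
  refine le_antisymm (h z) ?_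
  have := h (conj z)
  simpa [conj] using this

/-- The inverse of the sign of `e`, extended by `0` to the disjoint complement of `e`. -/
theorem exists_inverse_sign (hX : IsOrderContinuous X) (e : Complexification X) :
    ∃ V : Complexification X →ₗ[ℂ] Complexification X,
      (∀ z, modulus (V z) = bandProjection hX {modulus e} (modulus z)) ∧
      V e = ofReal (modulus e) := by
  -- The inverse of the sign of `e` is the sign of its conjugate: at a character the value of `e`
  -- has modulus 1, so its conjugate is its inverse.
  obtain ⟨S, hS, hφ⟩ := exists_sign_operator (conj e)
  have hu := modulus_nonneg e
  have huI := self_mem_principalIdeal hu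
  have hmem : ∀ z, bandProjectionC hX {modulus e} z ∈ closedIdeal (conj e) := fun z => by
    refine mem_closedIdeal_of_modulus_mem hX ?_
    rw [(modulus_bandProjectionC_and_sub hX _ z).1, modulus_conj]
    exact bandProjection_mem hX _ _
  let V := (closedIdeal (conj e)).subtype ∘ₗ S.toLinearMap ∘ₗ
    (bandProjectionC hX {modulus e}).codRestrict (closedIdeal (conj e)) hmem
  have hV : ∀ z, V z = (S ⟨bandProjectionC hX {modulus e} z, hmem z⟩ : Complexification X) :=
    fun z => rfl
  refine ⟨V, fun z => ?_, ?_⟩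
  · rw [hV, hS, (modulus_bandProjectionC_and_sub hX _ z).1]
  · have he : bandProjectionC hX {modulus e} e = e :=
      bandProjectionC_eq_self hX (subset_bandCompl_bandCompl _ rfl)
    have he₀ : bandProjectionC hX {modulus e} e ∈ ideal₀ (conj e) := by
      rw [he, mem_ideal₀_iff, modulus_conj]
      exact huI
    obtain ⟨h1, h2⟩ := hφ ⟨_, hmem e⟩ he₀
    rw [← hV] at h1 h2
    rw [mem_ideal₀_iff, modulus_conj] at h1
    refine eq_of_forall_extendFunctional hu h1 (by rwa [modulus_ofReal, abs_modulus])
      fun φ hφ' => ?_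
    have hc : extendFunctional φ (conj e) = (starRingEnd ℂ) (extendFunctional φ e) := by
      apply Complex.ext <;> simp [conj]
    have h3 := h2 φ (by rwa [modulus_conj])
    simp only [he] at h3
    rw [h3, hc, ← Complex.normSq_eq_conj_mul_self,
      Complex.normSq_eq_norm_sq, norm_extendFunctional_unit hφ', extendFunctional_ofReal,
      hφ'.map_unit, one_pow]

theorem modulus_sum_le {ι : Type*} (s : Finset ι) (f : ι → Complexification X) :
    modulus (∑ i ∈ s, f i) ≤ ∑ i ∈ s, modulus (f i) := by
  classical
  induction s using Finset.induction_on with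
  | empty => simp [modulus_zero]
  | insert i s hi ih =>
    rw [Finset.sum_insert hi, Finset.sum_insert hi]
    exact (modulus_add_le _ _).trans (add_le_add_right ih _)

/-- Band projections onto disjoint principal bands are summable. -/
theorem summable_bandProjection (hX : IsOrderContinuous X) {ι : Type*} {u : ι → X}
    (hu : ∀ i j, i ≠ j → |u i| ⊓ |u j| = 0) {r : X} (hr : 0 ≤ r) :
    Summable fun i => bandProjection hX {u i} r := by
  classical
  -- The projection onto the band of `u i` kills the sum `q` over the other indices, so applied to
  -- `r - q ≥ 0` it gives at most `r - q`. The finite partial sums are thus bounded and increasing.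
  have hle : ∀ s : Finset ι, ∑ i ∈ s, bandProjection hX {u i} r ≤ r := by
    intro s
    induction s using Finset.induction_on with
    | empty => simpa using hr
    | insert i s hi ih =>
      rw [Finset.sum_insert hi]
      set q := ∑ j ∈ s, bandProjection hX {u j} r with hq
      have hq0 : bandProjection hX {u i} q = 0 := by
        refine bandProjection_eq_zero hX (sum_mem fun j hj => ?_)
        refine mem_bandCompl_singleton_of_disjoint (hu i j ?_) (bandProjection_mem hX _ _)
        rintro rfl
        exact hi hj
      have h := bandProjection_le hX {u i} (sub_nonneg.2 ih)
      rw [map_sub, hq0, sub_zero, le_sub_iff_add_le] at h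
      exact h
  have hmono : Monotone fun s : Finset ι => ∑ i ∈ s, bandProjection hX {u i} r :=
    fun s t hst => Finset.sum_le_sum_of_subset_of_nonneg hst fun i _ _ =>
      bandProjection_nonneg hX _ hr
  obtain ⟨l, -, hl⟩ := exists_isLUB_tendsto hX hmono hle
  exact ⟨l, hl⟩

theorem summable_of_modulus_le {ι : Type*} {f : ι → Complexification X} {g : ι → X}
    (hg : Summable g) (hfg : ∀ i, modulus (f i) ≤ g i) : Summable f := by
  rw [summable_iff_vanishing_norm] at hg ⊢
  intro ε hε
  obtain ⟨s, hs⟩ := hg ε hε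
  refine ⟨s, fun t ht => lt_of_le_of_lt ?_ (hs t ht)⟩
  rw [norm_def]
  refine norm_le_norm_of_abs_le_abs ?_
  rw [abs_modulus]
  exact (modulus_sum_le t f).trans
    ((Finset.sum_le_sum fun i _ => hfg i).trans (le_abs_self _))

/-- There is a sign change that maps all members of a given disjoint family to their moduli. -/
theorem exists_isSignChange_of_disjoint (hX : IsOrderContinuous X) (S : Set (Complexification X))
    (hS : ∀ e ∈ S, ∀ f ∈ S, e ≠ f → modulus e ⊓ modulus f = 0) :
    ∃ U : Complexification X →ₗ[ℂ] Complexification X, IsSignChange U ∧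
      ∀ e ∈ S, U e = ofReal (modulus e) := by
  choose V hV hVe using fun e : Complexification X => exists_inverse_sign hX e
  let u : S → X := fun i => modulus (i : Complexification X)
  have hu : ∀ i j, i ≠ j → |u i| ⊓ |u j| = 0 := fun i j hij => by
    rw [abs_modulus, abs_modulus]
    exact hS _ i.2 _ j.2 fun h => hij (Subtype.ext h)
  -- The operator `I + ∑ T i` acts as `V i` on the band of `u i` and as the identity on what is
  -- disjoint from all these bands.
  let T : S → Complexification X →ₗ[ℂ] Complexification X := fun i =>
    V i - bandProjectionC hX {u i}
  have hT : ∀ i z, modulus (T i z) ≤ (2 : ℝ) • bandProjection hX {u i} (modulus z) := by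
    intro i z
    have h := modulus_add_le (V i z) (-bandProjectionC hX {u i} z)
    rw [modulus_neg, hV, (modulus_bandProjectionC_and_sub hX _ z).1, ← sub_eq_add_neg] at h
    rw [two_smul]
    exact h
  have hTmem : ∀ i z, modulus (T i z) ∈ bandCompl (bandCompl {u i} : Set X) := fun i z =>
    mem_bandCompl_of_abs_le (Submodule.smul_mem _ (2 : ℝ) (bandProjection_mem hX {u i} (modulus z)))
      (by rw [abs_modulus]; exact (hT i z).trans (le_abs_self _))
  have hsum : ∀ z, Summable fun i => T i z := fun z =>
    summable_of_modulus_le ((summable_bandProjection hX hu (modulus_nonneg z)).const_smul (2 : ℝ))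
      fun i => hT i z
  let U : Complexification X →ₗ[ℂ] Complexification X :=
    { toFun := fun z => z + ∑' i, T i z
      map_add' := fun z w => by
        simp only [map_add]
        rw [(hsum z).tsum_add (hsum w)]
        abel
      map_smul' := fun c z => by
        simp only [map_smul, RingHom.id_apply]
        rw [(hsum z).tsum_const_smul c, smul_add] }
  have hUz : ∀ z, U z = z + ∑' i, T i z := fun z => rfl
  let A : Set X := Set.range u
  refine ⟨U, fun z => ?_, fun e he => ?_⟩
  -- The projection of `w` onto each band of `u j` vanishes, so `w ∈ A^⊥`. The component of `w` in
  -- `A^⊥` vanishes too, because `U` does not alter that component of `z`.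
  · set w := modulus (U z) - modulus z with hw
    have h1 : ∀ j, bandProjection hX {u j} w = 0 := by
      intro j
      have hQ : bandProjectionC hX {u j} (∑' i, T i z) = T j z := by
        have := (hsum z).hasSum.map (bandProjectionC hX {u j}) (continuous_bandProjectionC hX _)
        refine this.unique ?_
        have hj : (bandProjectionC hX {u j}) (T j z) = T j z :=
          bandProjectionC_eq_self hX (hTmem j z)
        have := hasSum_single (f := bandProjectionC hX {u j} ∘ fun i => T i z) j fun i hij =>
          bandProjectionC_eq_zero hX (mem_bandCompl_singleton_of_disjoint (hu j i hij.symm)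
            (hTmem i z))
        simpa only [Function.comp_apply, hj] using this
      have hQU : bandProjectionC hX {u j} (U z) = V j z := by
        rw [hUz, map_add, hQ]
        simp [T]
      rw [hw, map_sub, ← (modulus_bandProjectionC_and_sub hX _ (U z)).1, hQU, hV, sub_self]
    have h2 : w - bandProjection hX A w = 0 := by
      have hQ : bandProjectionC hX A (∑' i, T i z) = ∑' i, T i z := by
        have := (hsum z).hasSum.map (bandProjectionC hX A) (continuous_bandProjectionC hX _)
        refine this.unique ?_
        have hi : (bandProjectionC hX A ∘ fun i => T i z) = fun i => T i z := by
          funext i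
          refine bandProjectionC_eq_self hX fun b hb => hTmem i z b ?_
          rintro _ rfl
          exact hb _ ⟨i, rfl⟩
        rw [hi]
        exact (hsum z).hasSum
      have hQU : U z - bandProjectionC hX A (U z) = z - bandProjectionC hX A z := by
        rw [hUz, map_add, hQ]
        abel
      have h3 := (modulus_bandProjectionC_and_sub hX A (U z)).2
      rw [hQU, (modulus_bandProjectionC_and_sub hX A z).2] at h3
      rw [hw, map_sub, sub_sub_sub_comm, h3, sub_self]
    have h3 : w ∈ bandCompl A := by
      rintro _ ⟨j, rfl⟩
      have := sub_bandProjection_mem hX {u j} w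
      rw [h1, sub_zero] at this
      exact this _ rfl
    rw [bandProjection_eq_zero hX h3, sub_zero] at h2
    exact sub_eq_zero.1 h2
  · have h1 : ∑' i, T i e = T ⟨e, he⟩ e := by
      refine tsum_eq_single _ fun i hi => ?_
      have h2 : bandProjection hX {u i} (modulus e) = 0 := by
        refine bandProjection_eq_zero hX ?_
        rintro _ rfl
        exact hu ⟨e, he⟩ i hi.symm
      have h3 := hT i e
      rw [h2, smul_zero] at h3
      rw [← norm_eq_zero, norm_def, le_antisymm h3 (modulus_nonneg _), norm_zero]
    have h2 : bandProjectionC hX {u ⟨e, he⟩} e = e :=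
      bandProjectionC_eq_self hX (subset_bandCompl_bandCompl _ rfl)
    rw [hUz, h1]
    simp only [T, LinearMap.sub_apply, h2, hVe]
    abel

theorem lacey_mem_of_isClosedSublatticeUpToSignChange (hX : IsOrderContinuous X)
    {E : Submodule ℂ (Complexification X)}
    (hE : IsClosedSublatticeUpToSignChange E) {x y : Complexification X} (hx : x ∈ E) (hy : y ∈ E) :
    lacey x y ∈ E := by
  obtain ⟨U, hU, Y, hYc, hY, hF⟩ := hE
  have hUx := (hF (U x)).1 (Submodule.mem_map_of_mem hx)
  have hUy := (hF (U y)).1 (Submodule.mem_map_of_mem hy)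
  have h := (hF _).2 (lacey_mem hYc hY (modulus_mem hX hYc hY hUx.1 hUx.2)
    (modulus_mem hX hYc hY hUy.1 hUy.2) hUy.1 hUy.2)
  rw [← hU.map_lacey] at h
  obtain ⟨e, he, heq⟩ := h
  rwa [← hU.injective heq]

/-- The expansion `|t + η| = t + Re η + O(1/t)` for `|η| = 1`, read at the characters for the unit
`|z|`. -/
theorem abs_modulus_add_sub_le (z : Complexification X) {t : ℝ} (ht : 2 ≤ t) :
    |modulus ((t : ℂ) • ofReal (modulus z) + z) - t • modulus z - z.re| ≤ t⁻¹ • modulus z := by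
  have hu := modulus_nonneg z
  have huI := self_mem_principalIdeal hu
  obtain ⟨hre, him⟩ := modulus_mem_principalIdeal.1 huI
  have hm : modulus ((t : ℂ) • ofReal (modulus z) + z) ∈ principalIdeal (modulus z) := by
    rw [modulus_mem_principalIdeal]
    simp only [ofReal, add_re, smul_re, add_im, smul_im, Complex.ofReal_re, Complex.ofReal_im,
      smul_zero, sub_zero, zero_smul, add_zero, zero_add]
    exact ⟨add_mem (Submodule.smul_mem _ _ huI) hre, him⟩
  refine abs_le_smul_of_forall_isCharacter hu
    (sub_mem (sub_mem hm (Submodule.smul_mem _ _ huI)) hre) fun φ hφ => ?_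
  have hη := norm_extendFunctional_unit hφ
  have hre' : φ z.re = (extendFunctional φ z).re := rfl
  rw [map_sub, map_sub, modulus_map_character hφ hu hm, map_smul, hφ.map_unit, map_add, map_smul,
    extendFunctional_ofReal, hφ.map_unit, hre', smul_eq_mul, smul_eq_mul, mul_one,
    Complex.ofReal_one, mul_one]
  set η := extendFunctional φ z
  have e1 : ‖(t : ℂ) + η‖ ^ 2 = (t + η.re) ^ 2 + η.im ^ 2 := by
    rw [← Complex.normSq_eq_norm_sq, Complex.normSq_apply]
    simp
    ring
  have e2 : η.re ^ 2 + η.im ^ 2 = 1 := by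
    have : ‖η‖ ^ 2 = η.re ^ 2 + η.im ^ 2 := by
      rw [← Complex.normSq_eq_norm_sq, Complex.normSq_apply]; ring
    rw [← this, hη, one_pow]
  have ht0 : 0 < t := by linarith
  have hlow : t + η.re ≤ ‖(t : ℂ) + η‖ := by
    simpa using Complex.re_le_norm ((t : ℂ) + η)
  have hη1 : -1 ≤ η.re := by nlinarith [sq_nonneg η.im]
  -- After squaring, it suffices that `η.im² ≤ 2(1 + t⁻¹ η.re)`. The left side is at most 1, and the
  -- right side is at least 1 since `t⁻¹ ≤ 1/2` and `η.re ≥ -1`; this is where `2 ≤ t` enters.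
  have hup : ‖(t : ℂ) + η‖ ≤ t + η.re + t⁻¹ := by
    have hti : 0 < t⁻¹ := inv_pos.2 ht0
    refine le_of_sq_le_sq ?_ (by linarith)
    have e3 : t * t⁻¹ = 1 := mul_inv_cancel₀ ht0.ne'
    have e4 : t⁻¹ ≤ 1 / 2 := by
      rw [inv_le_comm₀ ht0 (by norm_num)]
      norm_num
      exact ht
    rw [e1]
    nlinarith [sq_nonneg η.re, mul_nonneg hti.le (by linarith : 0 ≤ η.re + 1), sq_nonneg t⁻¹]
  rw [abs_le]
  constructor
  · have : 0 < t⁻¹ := inv_pos.2 ht0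
    linarith
  · linarith

/-- A closed subspace that contains the moduli of its elements is the complexification of a closed
sublattice. -/
theorem isClosedSublattice_of_modulus_mem {F : Submodule ℂ (Complexification X)}
    (hFc : IsClosed (F : Set (Complexification X))) (hF : ∀ z ∈ F, ofReal (modulus z) ∈ F) :
    IsClosedSublattice F := by
  have hsmul : ∀ (t : ℝ) (r : X), ofReal (t • r) = (t : ℂ) • ofReal r := fun t r => by
    ext <;> simp only [ofReal, smul_re, smul_im, Complex.ofReal_re, Complex.ofReal_im, smul_zero,
      zero_smul, sub_zero, add_zero]
  let Y : Submodule ℝ X :=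
    { carrier := {r | ofReal r ∈ F}
      zero_mem' := F.zero_mem
      add_mem' := fun {a b} ha hb => by
        rw [Set.mem_ofPred_eq, ofReal_add]; exact add_mem ha hb
      smul_mem' := fun t r hr => by
        rw [Set.mem_ofPred_eq, hsmul]; exact F.smul_mem _ hr }
  have hYmem : ∀ r, r ∈ Y ↔ ofReal r ∈ F := fun r => Iff.rfl
  have hYc : IsClosed (Y : Set X) := hFc.preimage continuous_ofReal
  have hYabs : ∀ r ∈ Y, |r| ∈ Y := fun r hr => by
    rw [hYmem, ← modulus_ofReal]; exact hF _ hr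
  have hre : ∀ z ∈ F, z.re ∈ Y := by
    intro z hz
    have hu : modulus z ∈ Y := hF z hz
    -- `Re z` is the limit of `|t|z| + z| - t|z|`, which lies in `Y`; the choice `t = n + 2` keeps
    -- `t ≥ 2`.
    have ht : Tendsto (fun n : ℕ => modulus ((((n : ℝ) + 2 : ℝ) : ℂ) • ofReal (modulus z) + z) -
        ((n : ℝ) + 2) • modulus z) atTop (𝓝 z.re) := by
      rw [tendsto_iff_norm_sub_tendsto_zero]
      have h0 : Tendsto (fun n : ℕ => ((n : ℝ) + 2)⁻¹ * ‖modulus z‖) atTop (𝓝 0) := by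
        have : Tendsto (fun n : ℕ => ((n : ℝ) + 2)⁻¹) atTop (𝓝 0) :=
          tendsto_inv_atTop_zero.comp
            (tendsto_atTop_add_const_right _ _ tendsto_natCast_atTop_atTop)
        simpa using this.mul_const ‖modulus z‖
      refine squeeze_zero (fun n => norm_nonneg _) (fun n => ?_) h0
      have h2 : (2 : ℝ) ≤ (n : ℝ) + 2 := by linarith [n.cast_nonneg (α := ℝ)]
      refine (norm_le_norm_of_abs_le_abs
        ((abs_modulus_add_sub_le z h2).trans (le_abs_self _))).trans ?_
      rw [norm_smul, Real.norm_of_nonneg (by positivity)]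
    refine hYc.mem_of_tendsto ht (Eventually.of_forall fun n => ?_)
    exact sub_mem (hF _ (add_mem (F.smul_mem _ hu) hz)) (Y.smul_mem _ hu)
  refine ⟨Y, hYc, fun x hx y hy => ?_, fun z => ⟨fun hz => ⟨hre z hz, ?_⟩, fun h => ?_⟩⟩
  · rw [sup_eq_smul, inf_eq_smul]
    exact ⟨Y.smul_mem _ (add_mem (add_mem hx hy) (hYabs _ (sub_mem hy hx))),
      Y.smul_mem _ (sub_mem (add_mem hx hy) (hYabs _ (sub_mem hy hx)))⟩
  · simpa using hre _ (F.smul_mem (-Complex.I) hz)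
  · rw [eq_ofReal_add z]
    exact add_mem h.1 (F.smul_mem _ h.2)

theorem lacey_ofReal {x : Complexification X} {c : X} (hc : 0 ≤ c) :
    lacey x (ofReal c) = ofReal (modulus x ⊓ c) := by
  symm
  apply eq_lacey
  · rw [modulus_ofReal, modulus_ofReal, abs_of_nonneg hc,
      abs_of_nonneg (le_inf (modulus_nonneg x) hc)]
  · rw [← ofReal_sub, modulus_ofReal, modulus_ofReal, abs_of_nonneg hc,
      abs_of_nonneg (sub_nonneg.2 inf_le_right)]

theorem isClosedSublatticeUpToSignChange_of_lacey_mem (hX : IsOrderContinuous X)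
    {E : Submodule ℂ (Complexification X)}
    (hEc : IsClosed (E : Set (Complexification X))) (hE : ∀ x ∈ E, ∀ y ∈ E, lacey x y ∈ E) :
    IsClosedSublatticeUpToSignChange E := by
  obtain ⟨S, hSE, hdisj, hmax⟩ := exists_maximal_disjoint modulus (E : Set (Complexification X))
  obtain ⟨U, hU, hUS⟩ := exists_isSignChange_of_disjoint hX S hdisj
  have hFc : IsClosed (E.map U : Set (Complexification X)) := by
    rw [Submodule.map_coe]
    exact hU.isometry.isClosedEmbedding.isClosedMap _ hEc
  refine ⟨U, hU, isClosedSublattice_of_modulus_mem hFc ?_⟩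
  rintro _ ⟨x, hx, rfl⟩
  rw [hU]
  change x ∈ E at hx
  obtain ⟨F, l, hF, hl0, hlx, ht, hd⟩ := exists_tendsto_inf hX
    (C := {c | ∃ g ∈ E, U g = ofReal (modulus g) ∧ modulus g = c})
    ⟨0, zero_mem _, by rw [map_zero, modulus_zero]; rfl, modulus_zero⟩
    (by rintro _ ⟨g, -, -, rfl⟩; exact modulus_nonneg g)
    (by
      rintro _ ⟨g, hg, hUg, rfl⟩ _ ⟨h, hh, hUh, rfl⟩
      have e : modulus (g + h) = modulus g + modulus h := by
        rw [← hU, map_add, hUg, hUh, ← ofReal_add, modulus_ofReal,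
          abs_of_nonneg (add_nonneg (modulus_nonneg _) (modulus_nonneg _))]
      exact ⟨g + h, add_mem hg hh, by rw [map_add, hUg, hUh, e, ofReal_add], e⟩) (modulus_nonneg x)
  choose g hgE hUg hgc using
    fun c : {c | ∃ g ∈ E, U g = ofReal (modulus g) ∧ modulus g = c} => c.2
  -- Here `v = S_x l`. As `S_x` preserves moduli, the distance from `b(g,x)` to `v` equals that from
  -- `|x| ∧ c` to `l`.
  let v : Complexification X :=
    sign x ⟨ofReal l, ofReal_mem_closedIdeal (by rwa [abs_of_nonneg hl0])⟩
  have htv : Tendsto (fun c => lacey (g c) x) F (𝓝 v) := by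
    rw [tendsto_iff_norm_sub_tendsto_zero] at ht ⊢
    refine ht.congr fun c => ?_
    rw [norm_def, lacey, ← Submodule.coe_sub, ← map_sub, (isSign_sign x).1, Submodule.coe_sub,
      infIn, ← ofReal_sub, modulus_ofReal, norm_abs_eq_norm, hgc, inf_comm]
  have hvE : v ∈ E := hEc.mem_of_tendsto htv (Eventually.of_forall fun c => hE _ (hgE c) _ hx)
  have hxv : modulus (x - v) = modulus x - l := by
    refine tendsto_nhds_unique
      ((continuous_modulus.tendsto _).comp (tendsto_const_nhds.sub htv)) ?_
    simp only [Function.comp_def, modulus_sub_lacey, hgc, inf_comm _ (modulus x)]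
    exact tendsto_const_nhds.sub ht
  have h0 : modulus (x - v) = 0 := hmax _ (sub_mem hx hvE) fun e he => by
    rw [hxv]
    exact hd _ ⟨e, hSE he, hUS e he, rfl⟩
  have hl : modulus x = l := by rw [← sub_eq_zero, ← hxv, h0]
  rw [hl]
  refine hFc.mem_of_tendsto ((continuous_ofReal.tendsto l).comp ht)
    (Eventually.of_forall fun c => ?_)
  refine ⟨lacey x (g c), hE _ hx _ (hgE c), ?_⟩
  have hc0 : 0 ≤ (c : X) := hgc c ▸ modulus_nonneg _
  rw [hU.map_lacey, hUg, hgc, lacey_ofReal hc0, hU, Function.comp_apply]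

end ComplexCase

end Complexification

end BLat

theorem proposition2p2 {X : Type*} [NormedAddCommGroup X] [NormedSpace ℝ X] [CompleteSpace X]
    [Lattice X] [IsOrderedAddMonoid X] [IsOrderedModule ℝ X] [HasSolidNorm X]
    (hX : BLat.IsOrderContinuous X) :
    (∀ E : Submodule ℝ X, IsClosed (E : Set X) →
      (BLat.IsClosedSublatticeUpToSignChange E ↔
        ∀ x ∈ E, ∀ y ∈ E, BLat.laceyReal x y ∈ E)) ∧
    (∀ E : Submodule ℂ (BLat.Complexification X), IsClosed (E : Set (BLat.Complexification X)) →
      (BLat.Complexification.IsClosedSublatticeUpToSignChange E ↔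
        ∀ x ∈ E, ∀ y ∈ E, BLat.Complexification.lacey x y ∈ E)) := by
  exact ⟨fun E hE => ⟨fun h _ hx _ hy =>
      BLat.laceyReal_mem_of_isClosedSublatticeUpToSignChange h hx hy,
      BLat.isClosedSublatticeUpToSignChange_of_laceyReal_mem hX hE⟩,
    fun E hE => ⟨fun h _ hx _ hy =>
      BLat.Complexification.lacey_mem_of_isClosedSublatticeUpToSignChange hX h hx hy,
      BLat.Complexification.isClosedSublatticeUpToSignChange_of_lacey_mem hX hE⟩⟩
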